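/- **Theorem 7.1.** For real (or integer) $a$ and integer $p$ let $\binom{a}{p}=\frac{a(a-1)\cdots(a-p+1)}{p!}$ if $p\ge 0$ and $\binom{a}{p}=0$ if $p<0$. For integers $\alpha,\beta$, real numbers $\gamma,\delta$ and an integer $n\ge 0$ put $$F_{\alpha,\beta,\gamma,\delta}(n):=\det_{0\le i,j\le n-1}\left(4^{i+\beta}\binom{i+2j+\gamma}{2j+\alpha}+\binom{-i+2j+\delta}{2j+\alpha}\right).$$ The following determinant evaluations hold for all $n\ge 1$: $$F_{1,0,1,1}(n)=2\prod_{i=1}^{n}\frac{3^{i-1}\,\Gamma(3i-1)\,\Gamma\left(\frac{i+1}{2}\right)}{\Gamma(2i)\,\Gamma\left(\frac{3i-1}{2}\right)},$$ $$F_{1,0,2,2}(n)=2\prod_{i=1}^{n}\frac{3^{i-1}\,\Gamma(3i)\,\Gamma\left(\frac{i}{2}\right)}{2\,\Gamma(2i)\,\Gamma\left(\frac{3i}{2}\right)},$$ $$F_{1,0,3,3}(n)=2\prod_{i=1}^{n}\frac{3^{i}\,\Gamma(3i-1)\,\Gamma\left(\frac{i+1}{2}\right)}{\Gamma(2i)\,\Gamma\left(\frac{3i-1}{2}\right)}.$$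 Moreover, the following identities hold for all $n\ge 4$: $$F_{1,0,1,1}(n)=\tfrac23\,F_{1,1,-1,-3}(n)=\tfrac1{21}\,F_{1,2,-3,-7}(n),$$ $$F_{1,0,2,2}(n)=-2\,F_{1,1,0,-2}(n)=\tfrac27\,F_{1,2,-2,-6}(n),$$ $$F_{1,0,3,3}(n)=2\,F_{1,1,1,-1}(n)=\tfrac25\,F_{1,2,-1,-5}(n)=\tfrac1{99}\,F_{1,3,-3,-9}(n),$$ $$F_{1,1,-1,-3}(n)=-6\,F_{3,2,2,-2}(n-1)=24\,F_{5,3,5,-1}(n-2),$$ $$F_{1,1,0,-2}(n)=-2\,F_{3,2,3,-1}(n-1).$$ -/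

import Mathlib

/-- The binomial coefficient `a (a - 1) ⋯ (a - p + 1) / p!` for integer `p ≥ 0`, and `0` for `p < 0`;
the upper argument `a` is arbitrary (in particular it may be negative). -/
noncomputable def genBinom (a : ℝ) (p : ℤ) : ℝ :=
  if 0 ≤ p then (∏ k ∈ Finset.range p.toNat, (a - (k : ℝ))) / (p.toNat.factorial : ℝ) else 0

/-- The determinant `F_{α,β,γ,δ}(n)` of the `n × n` matrix whose rows `i` and columns `j` are
indexed by `0, …, n - 1`. -/
noncomputable def detF (α β : ℤ) (γ δ : ℝ) (n : ℕ) : ℝ :=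
  Matrix.det (Matrix.of fun i j : Fin n =>
    (4 : ℝ) ^ (((i : ℕ) : ℤ) + β)
        * genBinom (((i : ℕ) : ℝ) + 2 * ((j : ℕ) : ℝ) + γ) (2 * ((j : ℕ) : ℤ) + α)
      + genBinom (-((i : ℕ) : ℝ) + 2 * ((j : ℕ) : ℝ) + δ) (2 * ((j : ℕ) : ℤ) + α))

/-! Put v = 1 - X and u = 4/v. For a suitable integer e, row i of the matrix lists coefficients of
v^e (u^(i+β) + v^(i+β)) (`detF_eq`). Since uv = 4, the power sum u^i + v^i is a polynomial of degree
i in g = 2 - (u+v)/2 (`pivotVar`). When α = 1 only the odd parts of the rows matter: even series may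
be added to rows, and a common even factor h multiplies the determinant by h(0)^n. Everything rests
on two even series, v(1-g) = (3+X²)/2 and v³g = -(1-X²)²/2.

Product formulas: for e = -k with k = 1, 2 the elimination is explicit. There are polynomials p_m of
degree m such that (1-X²)^(m+k) v^(-k) p_m(g) has odd part X^(2m+1) q_m(X²) with q_m(0) = 1, so the
m-th pivot is the reciprocal of the leading coefficient of p_m. They are built by a three-term
recurrence (`IsPivotPoly.step`) that uses v³(g-4)(1+2g)² = -X²(9-X²)²/2. The delicate point is that
q_m(0) = 1 persists; it follows from differential relations between q_m and q_(m+1)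
(`ladderPoly_derivative`). The case k = 3 is compared with k = 1 through the two even series
(`baseDet_three`).

Shifted determinants: modulo even series, rows with exponent 3m - k become (v³g)^m v^(-k) times
polynomials in g whose coefficient matrix is triangular outside a 4 × 4 block. Hence the ratio to
the unshifted determinant is constant from n = 4 on (`detF_shift`). The identities that lower n come
from a first row with a single nonzero entry. -/

/-! ### Even power series and determinants of odd coefficients -/

/-- A power series is even if it is invariant under `X ↦ -X`. -/
def IsEvenSeries (f : PowerSeries ℝ) : Prop := PowerSeries.rescale (-1 : ℝ) f = f

namespace IsEvenSeries

open PowerSeries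

variable {f g : PowerSeries ℝ}

theorem coeff_eq_zero (hf : IsEvenSeries f) (j : ℕ) : coeff (2 * j + 1) f = 0 := by
  have h := congrArg (coeff (2 * j + 1)) hf
  rw [coeff_rescale, pow_succ, pow_mul] at h
  norm_num at h
  linarith

theorem add (hf : IsEvenSeries f) (hg : IsEvenSeries g) : IsEvenSeries (f + g) := by
  unfold IsEvenSeries at *
  rw [map_add, hf, hg]

theorem sub (hf : IsEvenSeries f) (hg : IsEvenSeries g) : IsEvenSeries (f - g) := by
  unfold IsEvenSeries at *
  rw [map_sub, hf, hg]

theorem mul (hf : IsEvenSeries f) (hg : IsEvenSeries g) : IsEvenSeries (f * g) := by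
  unfold IsEvenSeries at *
  rw [map_mul, hf, hg]

theorem pow (hf : IsEvenSeries f) (n : ℕ) : IsEvenSeries (f ^ n) := by
  unfold IsEvenSeries at *
  rw [map_pow, hf]

theorem const (a : ℝ) : IsEvenSeries (C a) := by
  unfold IsEvenSeries
  ext n
  rcases n with _ | n <;> simp [coeff_rescale, coeff_C]

theorem X_sq : IsEvenSeries ((X : PowerSeries ℝ) ^ 2) := by
  unfold IsEvenSeries
  rw [map_pow, rescale_X]
  simp

end IsEvenSeries

open PowerSeries in
/-- The determinant of the coefficients of `X, X ^ 3, …, X ^ (2 n - 1)` in the series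
`f 0, …, f (n - 1)`. -/
noncomputable def oddDet (f : ℕ → PowerSeries ℝ) (n : ℕ) : ℝ :=
  Matrix.det (Matrix.of fun i j : Fin n => coeff (2 * (j : ℕ) + 1) (f i))

theorem oddDet_congr {f g : ℕ → PowerSeries ℝ} {n : ℕ}
    (h : ∀ i < n, IsEvenSeries (f i - g i)) : oddDet f n = oddDet g n := by
  unfold oddDet
  congr 1
  ext i j
  have := (h i i.2).coeff_eq_zero j
  rw [map_sub, sub_eq_zero] at this
  simpa using this

theorem sum_range_two_mul (F : ℕ → ℝ) (m : ℕ) :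
    ∑ k ∈ Finset.range (2 * m), F k = ∑ l ∈ Finset.range m, (F (2 * l) + F (2 * l + 1)) := by
  induction m with
  | zero => simp
  | succ m ih => rw [Nat.mul_succ, Finset.sum_range_succ, Finset.sum_range_succ, ih,
      Finset.sum_range_succ, add_assoc]

open PowerSeries in
theorem IsEvenSeries.coeff_mul_odd {h : PowerSeries ℝ} (hh : IsEvenSeries h) (f : PowerSeries ℝ)
    (j : ℕ) : coeff (2 * j + 1) (h * f) =
      ∑ l ∈ Finset.range (j + 1), coeff (2 * l + 1) f * coeff (2 * (j - l)) h := by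
  rw [mul_comm h f, coeff_mul, Finset.Nat.sum_antidiagonal_eq_sum_range_succ
    (fun a b => coeff a f * coeff b h), show (2 * j + 1).succ = 2 * (j + 1) by omega,
    sum_range_two_mul]
  refine Finset.sum_congr rfl fun l hl => ?_
  have hl : l ≤ j := by simpa [Nat.lt_succ_iff] using hl
  rw [show 2 * j + 1 - 2 * l = 2 * (j - l) + 1 by omega, hh.coeff_eq_zero,
    show 2 * j + 1 - (2 * l + 1) = 2 * (j - l) by omega]
  ring

open PowerSeries in
-- On odd coefficients, multiplication by an even series acts as the upper triangular Toeplitz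
-- matrix of its even coefficients, with the constant term on the diagonal.
theorem oddDet_even_mul {h : PowerSeries ℝ} (hh : IsEvenSeries h) (f : ℕ → PowerSeries ℝ)
    (n : ℕ) : oddDet (fun i => h * f i) n = constantCoeff h ^ n * oddDet f n := by
  let U : Matrix (Fin n) (Fin n) ℝ := Matrix.of fun l j =>
    if (l : ℕ) ≤ j then coeff (2 * ((j : ℕ) - l)) h else 0
  have hU : U.det = constantCoeff h ^ n := by
    rw [Matrix.det_of_isUpperTriangular]
    · simp [U]
    · intro i j hij
      have : ¬ (i ≤ j) := by simpa using hij
      simp [U, this]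
  have hM : (Matrix.of fun i j : Fin n => coeff (2 * (j : ℕ) + 1) (h * f i)) =
      (Matrix.of fun i j : Fin n => coeff (2 * (j : ℕ) + 1) (f i)) * U := by
    ext i j
    rw [Matrix.mul_apply, Matrix.of_apply, hh.coeff_mul_odd]
    simp only [Matrix.of_apply, U, mul_ite, mul_zero]
    rw [Fin.sum_univ_eq_sum_range (fun l => if l ≤ (j : ℕ) then
      coeff (2 * l + 1) (f i) * coeff (2 * ((j : ℕ) - l)) h else 0) n, ← Finset.sum_filter]
    refine Finset.sum_congr ?_ fun _ _ => rfl
    ext l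
    have := j.2
    simp only [Finset.mem_range, Finset.mem_filter]
    omega
  unfold oddDet
  rw [hM, Matrix.det_mul, hU, mul_comm]

/-! ### Rows that are polynomials in one series -/

/-- The determinant of the coefficients of `1, X, …, X ^ (n - 1)` in the polynomials
`p 0, …, p (n - 1)`. -/
noncomputable def coeffDet (p : ℕ → Polynomial ℝ) (n : ℕ) : ℝ :=
  Matrix.det (Matrix.of fun i j : Fin n => (p i).coeff j)

theorem oddDet_aeval (ω γ : PowerSeries ℝ) (p : ℕ → Polynomial ℝ) (n : ℕ)
    (hp : ∀ i < n, (p i).natDegree < n) :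
    oddDet (fun i => ω * Polynomial.aeval γ (p i)) n =
      coeffDet p n * oddDet (fun i => ω * γ ^ i) n := by
  unfold oddDet coeffDet
  rw [← Matrix.det_mul]
  congr 1
  ext i j
  simp only [Matrix.mul_apply, Matrix.of_apply]
  rw [Polynomial.aeval_eq_sum_range' (hp i i.2), Finset.mul_sum, map_sum, Finset.sum_range]
  refine Finset.sum_congr rfl fun k _ => ?_
  simp

/-- Expansion along the last column. It asks for vanishing in that column only, so it also serves
matrices that are triangular merely outside a block. -/
theorem coeffDet_succ (p : ℕ → Polynomial ℝ) (n : ℕ) (hp : ∀ i < n, (p i).coeff n = 0) :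
    coeffDet p (n + 1) = coeffDet p n * (p n).coeff n := by
  unfold coeffDet
  rw [Matrix.det_succ_column _ (Fin.last n), Finset.sum_eq_single (Fin.last n)]
  · simp only [Fin.val_last, Matrix.of_apply, ← two_mul, pow_mul]
    norm_num
    rw [mul_comm]
    congr 1
  · intro i _ hi
    have : (i : ℕ) < n := Fin.val_lt_last hi
    simp [hp i this]
  · simp

theorem coeffDet_triangular (p : ℕ → Polynomial ℝ) (n : ℕ) (hp : ∀ i, (p i).natDegree ≤ i) :
    coeffDet p n = ∏ i ∈ Finset.range n, (p i).coeff i := by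
  induction n with
  | zero => simp [coeffDet]
  | succ n ih =>
    rw [coeffDet_succ, ih, Finset.prod_range_succ]
    exact fun i hi => Polynomial.coeff_eq_zero_of_natDegree_lt ((hp i).trans_lt hi)

open PowerSeries in
theorem oddDet_succ_of_last (f : ℕ → PowerSeries ℝ) (n : ℕ)
    (hf : ∀ j < n, coeff (2 * j + 1) (f n) = 0) :
    oddDet f (n + 1) = oddDet f n * coeff (2 * n + 1) (f n) := by
  unfold oddDet
  rw [Matrix.det_succ_row _ (Fin.last n), Finset.sum_eq_single (Fin.last n)]
  · simp only [Fin.val_last, Matrix.of_apply, ← two_mul, pow_mul]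
    norm_num
    rw [mul_comm]
    congr 1
  · intro i _ hi
    have : (i : ℕ) < n := Fin.val_lt_last hi
    simp [hf i this]
  · simp

open PowerSeries in
/-- If `ω * p(γ)` has no odd terms below `X ^ (2 n + 1)`, with `p` of degree at most `n`, then
the pivot of the last row can be read off. -/
theorem oddDet_pow_succ (ω γ : PowerSeries ℝ) (n : ℕ) (p : Polynomial ℝ) (hp : p.natDegree ≤ n)
    (h0 : ∀ j < n, coeff (2 * j + 1) (ω * Polynomial.aeval γ p) = 0) :
    p.coeff n * oddDet (fun i => ω * γ ^ i) (n + 1) =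
      coeff (2 * n + 1) (ω * Polynomial.aeval γ p) * oddDet (fun i => ω * γ ^ i) n := by
  -- Only the last power is exchanged for `p`, so the change of basis is triangular with determinant
  -- `p.coeff n`. The value 0 beyond `n` just keeps the degree bound valid everywhere.
  let P : ℕ → Polynomial ℝ := fun i => if i < n then Polynomial.X ^ i else if i = n then p else 0
  have hPn : P n = p := by simp [P]
  have hPlt : ∀ i < n, P i = Polynomial.X ^ i := fun i hi => by simp [P, hi]
  have hdeg : ∀ i, (P i).natDegree ≤ i := by
    intro i
    rcases lt_trichotomy i n with h | h | h
    · rw [hPlt i h, Polynomial.natDegree_X_pow]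
    · rw [h, hPn]; exact hp
    · simp [P, h.ne', h.not_gt]
  have h1 := oddDet_aeval ω γ P (n + 1) fun i hi => (hdeg i).trans_lt hi
  rw [coeffDet_triangular P (n + 1) hdeg, Finset.prod_range_succ, hPn,
    Finset.prod_eq_one (fun i hi => by
      rw [hPlt i (Finset.mem_range.1 hi)]; simp), one_mul] at h1
  rw [← h1, oddDet_succ_of_last _ _ (by simpa only [hPn] using h0), hPn, mul_comm]
  congr 1
  unfold oddDet
  congr 1
  ext i j
  simp [hPlt i i.2]

/-! ### Binomial coefficients as coefficients of integer powers of 1 - X -/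

open PowerSeries in
/-- The power series `1 - X` as a unit. -/
noncomputable def oneSubX : (PowerSeries ℝ)ˣ :=
  Units.mkOfMulEqOne (1 - X) (mk 1) (by rw [mul_comm]; exact mk_one_mul_one_sub_eq_one ℝ)

open PowerSeries in
@[simp]
theorem oneSubX_val : (oneSubX : PowerSeries ℝ) = 1 - X := rfl

theorem genBinom_natCast (a : ℝ) (p : ℕ) :
    genBinom a p = (∏ k ∈ Finset.range p, (a - (k : ℝ))) / (p.factorial : ℝ) := by
  simp [genBinom]

theorem genBinom_pascal (a : ℝ) (p : ℕ) :
    genBinom (a + 1) ((p + 1 : ℕ) : ℤ) = genBinom a ((p + 1 : ℕ) : ℤ) + genBinom a (p : ℤ) := by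
  have h1 : (∏ k ∈ Finset.range (p + 1), (a + 1 - (k : ℝ))) =
      (a + 1) * ∏ k ∈ Finset.range p, (a - (k : ℝ)) := by
    rw [Finset.prod_range_succ', mul_comm]
    congr 1
    · simp
    · refine Finset.prod_congr rfl fun k _ => ?_
      push_cast
      ring
  rw [genBinom_natCast, genBinom_natCast, genBinom_natCast, h1, Finset.prod_range_succ,
    Nat.factorial_succ]
  have : (p.factorial : ℝ) ≠ 0 := by positivity
  push_cast
  field_simp
  ring

/-- The series with coefficients `binom(a + p, p)`. -/
noncomputable def binomShift (a : ℝ) : PowerSeries ℝ :=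
  PowerSeries.mk fun p => genBinom (a + p) p

open PowerSeries in
theorem oneSubX_mul_binomShift (a : ℝ) :
    (oneSubX : PowerSeries ℝ) * binomShift a = binomShift (a - 1) := by
  ext p
  rw [oneSubX_val, sub_mul, one_mul, map_sub]
  rcases p with _ | p
  · simp [binomShift, genBinom]
  · rw [mul_comm, coeff_succ_mul_X]
    simp only [binomShift, coeff_mk]
    have h := genBinom_pascal (a + p) p
    have e1 : a + ((p + 1 : ℕ) : ℝ) = a + p + 1 := by push_cast; ring
    have e2 : a - 1 + ((p + 1 : ℕ) : ℝ) = a + p := by push_cast; ring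
    rw [e1, e2, h]
    ring

open PowerSeries in
theorem binomShift_neg_one : binomShift (-1) = 1 := by
  ext p
  rcases p with _ | p
  · simp [binomShift, genBinom]
  · simp only [binomShift, coeff_mk, coeff_one, Nat.succ_ne_zero, if_false]
    rw [genBinom_natCast, Finset.prod_range_succ]
    simp

/-- Pascal's rule says that multiplication by 1 - X lowers the parameter by one; from `binomShift
(-1) = 1` this reaches every integer exponent in both directions. -/
theorem binomShift_intCast (z : ℤ) :
    binomShift ((z : ℝ) - 1) = ((oneSubX ^ (-z) : (PowerSeries ℝ)ˣ) : PowerSeries ℝ) := by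
  induction z using Int.induction_on with
  | zero => simp [binomShift_neg_one]
  | succ n ih =>
    have h := oneSubX_mul_binomShift ((n : ℝ))
    push_cast at ih
    rw [ih] at h
    have e : (((n : ℤ) + 1 : ℤ) : ℝ) - 1 = n := by push_cast; ring
    rw [e, ← (Units.inv_mul_eq_iff_eq_mul oneSubX).2 h.symm, ← Units.val_mul]
    congr 1
    rw [neg_add, zpow_add, zpow_neg_one, mul_comm]
  | pred n ih =>
    have h := oneSubX_mul_binomShift (((-(n : ℤ) : ℤ) : ℝ) - 1)
    have e : ((-(n : ℤ) - 1 : ℤ) : ℝ) - 1 = ((-(n : ℤ) : ℤ) : ℝ) - 1 - 1 := by push_cast; ring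
    rw [e, ← h, ih, ← Units.val_mul]
    congr 1
    rw [neg_sub, sub_neg_eq_add, neg_neg, add_comm, zpow_add, zpow_one, mul_comm, zpow_natCast]

open PowerSeries in
theorem coeff_oneSubX_zpow (z : ℤ) (p : ℕ) :
    coeff p ((oneSubX ^ z : (PowerSeries ℝ)ˣ) : PowerSeries ℝ) = genBinom (p - z - 1) p := by
  rw [← neg_neg z, ← binomShift_intCast, binomShift, coeff_mk]
  push_cast
  congr 1
  ring

/-- The series `4 / (1 - X)`. -/
noncomputable def fourDiv : PowerSeries ℝ :=
  4 * ((oneSubX⁻¹ : (PowerSeries ℝ)ˣ) : PowerSeries ℝ)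

theorem oneSubX_mul_fourDiv : (oneSubX : PowerSeries ℝ) * fourDiv = 4 := by
  unfold fourDiv
  rw [mul_left_comm, Units.mul_inv, mul_one]

/-- The series `(1 - X) ^ e * ((4 / (1 - X)) ^ i + (1 - X) ^ i)`. -/
noncomputable def rowSeries (e : ℤ) (i : ℕ) : PowerSeries ℝ :=
  ((oneSubX ^ e : (PowerSeries ℝ)ˣ) : PowerSeries ℝ) * (fourDiv ^ i + (oneSubX : PowerSeries ℝ) ^ i)

open PowerSeries in
theorem rowSeries_eq (e : ℤ) (i : ℕ) : rowSeries e i =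
    C ((4 : ℝ) ^ i) * ((oneSubX ^ (e - i) : (PowerSeries ℝ)ˣ) : PowerSeries ℝ) +
      ((oneSubX ^ (e + i) : (PowerSeries ℝ)ˣ) : PowerSeries ℝ) := by
  rw [rowSeries, fourDiv, mul_add, mul_pow, zpow_sub, zpow_add, zpow_natCast]
  simp only [Units.val_mul, Units.val_pow_eq_pow_val, ← inv_pow, map_pow]
  have : (C (4 : ℝ)) = (4 : PowerSeries ℝ) := map_ofNat _ 4
  rw [this]
  ring

open PowerSeries in
-- In each binomial, upper minus lower argument is ±i plus a constant, which determines a power of 1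
-- - X. The shift `e` makes the two exponents e - (i+m) and e + (i+m); this is possible because γ -
-- δ = 2m.
theorem detF_eq (α m : ℕ) (e : ℤ) (γ δ : ℝ) (n : ℕ) (hγ : γ = m + α - 1 - e)
    (hδ : δ = α - 1 - m - e) : detF α m γ δ n =
      Matrix.det (Matrix.of fun i j : Fin n => coeff (2 * (j : ℕ) + α) (rowSeries e (i + m))) := by
  unfold detF
  congr 1
  ext i j
  simp only [Matrix.of_apply]
  rw [rowSeries_eq, map_add, coeff_C_mul, coeff_oneSubX_zpow, coeff_oneSubX_zpow, hγ, hδ]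
  have h : (2 * ((j : ℕ) : ℤ) + (α : ℤ)) = ((2 * (j : ℕ) + α : ℕ) : ℤ) := by push_cast; ring
  rw [h]
  congr 1
  · rw [← Nat.cast_add, zpow_natCast]
    congr 2
    push_cast
    ring
  · congr 1
    push_cast
    ring

/-! ### Rows as polynomials in `pivotVar` -/

/-- The variable in which all rows are polynomials, up to a common factor. -/
noncomputable def pivotVar : PowerSeries ℝ :=
  2 - PowerSeries.C (1 / 2) * (fourDiv + (oneSubX : PowerSeries ℝ))

theorem fourDiv_add_oneSubX : fourDiv + (oneSubX : PowerSeries ℝ) = 4 - 2 * pivotVar := by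
  have h : (2 : PowerSeries ℝ) * PowerSeries.C (1 / 2) = 1 := by
    rw [← map_ofNat PowerSeries.C 2, ← map_mul]
    norm_num
  unfold pivotVar
  linear_combination -(fourDiv + (oneSubX : PowerSeries ℝ)) * h

/-- Polynomials with `powerSum i (pivotVar) = (4 / (1 - X)) ^ i + (1 - X) ^ i`. -/
noncomputable def powerSum : ℕ → Polynomial ℝ
  | 0 => 2
  | 1 => 4 - 2 * Polynomial.X
  | i + 2 => (4 - 2 * Polynomial.X) * powerSum (i + 1) - 4 * powerSum i

/-- Newton's recurrence for power sums of two quantities with sum 4 - 2g and product 4. -/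
theorem aeval_powerSum (i : ℕ) : Polynomial.aeval pivotVar (powerSum i) =
    fourDiv ^ i + (oneSubX : PowerSeries ℝ) ^ i := by
  induction i using Nat.twoStepInduction with
  | zero => rw [powerSum, map_ofNat]; norm_num
  | one =>
    rw [pow_one, pow_one, fourDiv_add_oneSubX]
    rw [powerSum, map_sub, map_mul, map_ofNat, map_ofNat, Polynomial.aeval_X]
  | more i h1 h2 =>
    rw [powerSum, map_sub, map_mul, map_mul, h1, h2]
    simp only [map_sub, map_mul, map_ofNat, Polynomial.aeval_X]
    rw [← fourDiv_add_oneSubX]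
    linear_combination (fourDiv ^ i + (oneSubX : PowerSeries ℝ) ^ i) * oneSubX_mul_fourDiv

theorem rowSeries_eq_aeval (e : ℤ) (i : ℕ) : rowSeries e i =
    ((oneSubX ^ e : (PowerSeries ℝ)ˣ) : PowerSeries ℝ) *
      Polynomial.aeval pivotVar (powerSum i) := by
  rw [aeval_powerSum, rowSeries]

theorem natDegree_four_sub_le : (4 - 2 * Polynomial.X : Polynomial ℝ).natDegree ≤ 1 := by
  compute_degree

theorem powerSum_natDegree_le (i : ℕ) : (powerSum i).natDegree ≤ i := by
  induction i using Nat.twoStepInduction with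
  | zero => simp [powerSum]
  | one => exact natDegree_four_sub_le
  | more i h1 h2 =>
    rw [powerSum]
    refine (Polynomial.natDegree_sub_le _ _).trans (max_le ?_ ?_)
    · exact (Polynomial.natDegree_mul_le.trans (add_le_add natDegree_four_sub_le h2)).trans
        (by omega)
    · refine (Polynomial.natDegree_mul_le.trans (add_le_add
        (Polynomial.natDegree_ofNat 4).le h1)).trans (by omega)

theorem powerSum_coeff_succ (i : ℕ) : (powerSum (i + 1)).coeff (i + 1) = (-2) ^ (i + 1) := by
  induction i with
  | zero => simp [powerSum]
  | succ i ih =>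
    have h0 : (powerSum (i + 1)).coeff (i + 1 + 1) = 0 :=
      Polynomial.coeff_eq_zero_of_natDegree_lt
        ((powerSum_natDegree_le _).trans_lt (Nat.lt_succ_self _))
    have h1 : (powerSum i).coeff (i + 1 + 1) = 0 :=
      Polynomial.coeff_eq_zero_of_natDegree_lt
        ((powerSum_natDegree_le _).trans_lt (by omega))
    have e : powerSum (i + 1 + 1) = Polynomial.C 4 * powerSum (i + 1) -
        Polynomial.C 2 * (Polynomial.X * powerSum (i + 1)) - Polynomial.C 4 * powerSum i := by
      rw [powerSum]
      simp only [map_ofNat]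
      ring
    rw [e, Polynomial.coeff_sub, Polynomial.coeff_sub, Polynomial.coeff_C_mul,
      Polynomial.coeff_C_mul, Polynomial.coeff_C_mul, Polynomial.coeff_X_mul, h0, h1, ih]
    ring

/-- The factor 2 in front of all the product formulas is the power sum of index 0. -/
theorem coeffDet_powerSum_succ (n : ℕ) :
    coeffDet powerSum (n + 1) = 2 * ∏ i ∈ Finset.range n, (-2) ^ (i + 1) := by
  rw [coeffDet_triangular _ _ powerSum_natDegree_le, Finset.prod_range_succ', mul_comm]
  congr 1
  · rw [powerSum]; simp
  · exact Finset.prod_congr rfl fun i _ => powerSum_coeff_succ i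

/-- The determinant of the odd coefficients of `(1 - X) ^ (-k) * pivotVar ^ i`. -/
noncomputable def baseDet (k : ℕ) (n : ℕ) : ℝ :=
  oddDet (fun i => ((oneSubX ^ (-(k : ℤ)) : (PowerSeries ℝ)ˣ) : PowerSeries ℝ) * pivotVar ^ i) n

theorem detF_one_zero (k : ℕ) (n : ℕ) :
    detF 1 0 k k n = coeffDet powerSum n * baseDet k n := by
  have h := detF_eq 1 0 (-(k : ℤ)) k k n (by push_cast; ring) (by push_cast; ring)
  rw [Nat.cast_one, Nat.cast_zero] at h
  rw [h, baseDet, ← oddDet_aeval _ _ _ _ fun i hi => (powerSum_natDegree_le i).trans_lt hi]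
  simp only [oddDet, ← rowSeries_eq_aeval, Nat.add_zero]

/-! ### Ladder polynomials and their differential relations -/

/-- The coefficient of the recurrence satisfied by `ladderPoly`. -/
noncomputable def ladderCoeff (k : ℝ) (m : ℕ) : ℝ :=
  (2 * m + 3) * (2 * m + 5) / (27 * (9 * (m + 2) ^ 2 - k ^ 2))

open Polynomial in
/-- The polynomials describing, up to a common factor, the odd part of the `m`-th pivot row. -/
noncomputable def ladderPoly (k : ℝ) : ℕ → ℝ[X]
  | 0 => 1
  | 1 => 1 + C ((k - 1) / 15) * X
  | m + 2 => C (ladderCoeff k m) *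
      divX ((9 - X) ^ 2 * ladderPoly k m - 81 * (1 - X) * ladderPoly k (m + 1))

theorem ladderCoeff_denom_pos {k : ℝ} (hk : (k - 1) * (k - 2) = 0) (m : ℕ) :
    0 < 9 * ((m : ℝ) + 2) ^ 2 - k ^ 2 := by
  have : k = 1 ∨ k = 2 := by
    rcases mul_eq_zero.1 hk with h | h
    · left; linarith
    · right; linarith
  have hm : (0 : ℝ) ≤ m := m.cast_nonneg
  rcases this with rfl | rfl <;> nlinarith

open Polynomial in
-- With both constant terms equal to 1, the bracket takes the value 81 - 81 at 0, so `divX` is exact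
-- division.
theorem X_mul_ladderPoly_of_coeff_zero (k : ℝ) (m : ℕ) (h0 : (ladderPoly k m).coeff 0 = 1)
    (h1 : (ladderPoly k (m + 1)).coeff 0 = 1) : X * ladderPoly k (m + 2) =
      C (ladderCoeff k m) *
        ((9 - X) ^ 2 * ladderPoly k m - 81 * (1 - X) * ladderPoly k (m + 1)) := by
  rw [ladderPoly]
  set r := (9 - X) ^ 2 * ladderPoly k m - 81 * (1 - X) * ladderPoly k (m + 1) with hr
  have h : r.coeff 0 = 0 := by
    rw [coeff_zero_eq_eval_zero] at *
    simp [hr, h0, h1]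
    norm_num
  have := X_mul_divX_add r
  rw [h, map_zero, add_zero] at this
  rw [mul_left_comm, this]

/-- Inductive step for the first differential relation, with polynomials and derivatives as free
variables: `hr` is the recurrence and `hd` its derivative. The common factor on both sides is left
for the caller to cancel. -/
theorem ladder_step_aux {R : Type*} [CommRing R] (m k x q0 q1 q2 d0 d1 d2 : R)
    (h1 : 6 * (x * (9 - x) * (3 + x)) * d1 =
      (-81 * (2 * m + 3) + 3 * (15 * m + 9 + 9 * k) * x - 3 * (m + k) * x ^ 2) * q1 +
        (2 * m + 3) * (9 - x) ^ 2 * q0)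
    (h2 : 2 * (2 * m + 3) * (x * (9 - x) * (3 + x)) * d0 =
      9 * (9 * (m + 1) ^ 2 - k ^ 2) * x * q1 +
        (2 * m + 3) * x * (-39 * m - 33 + 9 * k - (m - 1 + k) * x) * q0)
    (hr : 27 * (9 * (m + 2) ^ 2 - k ^ 2) * (x * q2) =
      (2 * m + 3) * (2 * m + 5) * ((9 - x) ^ 2 * q0 - 81 * (1 - x) * q1))
    (hd : 27 * (9 * (m + 2) ^ 2 - k ^ 2) * (q2 + x * d2) =
      (2 * m + 3) * (2 * m + 5) *
        ((9 - x) ^ 2 * d0 - 2 * (9 - x) * q0 - 81 * (1 - x) * d1 + 81 * q1)) :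
    27 * (9 * (m + 2) ^ 2 - k ^ 2) * x * (6 * (x * (9 - x) * (3 + x)) * d2) =
      27 * (9 * (m + 2) ^ 2 - k ^ 2) * x *
      ((-81 * (2 * (m + 1) + 3) + 3 * (15 * (m + 1) + 9 + 9 * k) * x -
        3 * ((m + 1) + k) * x ^ 2) * q2 + (2 * (m + 1) + 3) * (9 - x) ^ 2 * q1) := by
  linear_combination 6 * (x * (9 - x) * (3 + x)) * hd + 3 * (2 * m + 5) * (9 - x) ^ 2 * h2
    - 81 * (1 - x) * (2 * m + 3) * (2 * m + 5) * h1
    - 6 * (9 - x) * (3 + x) * hr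
    - (-81 * (2 * m + 5) + 3 * (15 * m + 24 + 9 * k) * x - 3 * (m + 1 + k) * x ^ 2) * hr

open Polynomial in
/-- Two first order differential relations between consecutive `ladderPoly`s. -/
theorem ladderPoly_derivative {k : ℝ} (hk : (k - 1) * (k - 2) = 0) (m : ℕ) :
    (ladderPoly k m).coeff 0 = 1 ∧ (ladderPoly k (m + 1)).coeff 0 = 1 ∧
    6 * (X * (9 - X) * (3 + X)) * derivative (ladderPoly k (m + 1)) =
      (-81 * (2 * (m : ℝ[X]) + 3) + 3 * (15 * (m : ℝ[X]) + 9 + 9 * C k) * X -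
        3 * ((m : ℝ[X]) + C k) * X ^ 2) * ladderPoly k (m + 1) +
        (2 * (m : ℝ[X]) + 3) * (9 - X) ^ 2 * ladderPoly k m ∧
    2 * (2 * (m : ℝ[X]) + 3) * (X * (9 - X) * (3 + X)) * derivative (ladderPoly k m) =
      9 * (9 * ((m : ℝ[X]) + 1) ^ 2 - C k ^ 2) * X * ladderPoly k (m + 1) +
        (2 * (m : ℝ[X]) + 3) * X *
          (-39 * (m : ℝ[X]) - 33 + 9 * C k - ((m : ℝ[X]) - 1 + C k) * X) * ladderPoly k m := by
  induction m with
  | zero =>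
    set c : ℝ := (k - 1) / 15 with hc
    have hkc : k = 1 + 15 * c := by rw [hc]; ring
    -- The condition k = 1 or k = 2 reads c = 0 or c = 1/15; both base relations hold modulo this
    -- product.
    have hC : (C c : ℝ[X]) * (15 * C c - 1) = 0 := by
      have h : c * (15 * c - 1) = 0 := by rw [hkc] at hk; linarith
      have := congrArg (C : ℝ →+* ℝ[X]) h
      simpa only [map_mul, map_sub, map_ofNat, map_one, map_zero] using this
    have hkC : (C k : ℝ[X]) = 1 + 15 * C c := by
      rw [hkc]
      simp only [map_mul, map_add, map_ofNat, map_one]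
    refine ⟨by simp [ladderPoly], by simp [ladderPoly], ?_, ?_⟩
    · simp only [ladderPoly, Nat.cast_zero, derivative_add, derivative_one, derivative_mul,
        derivative_C, derivative_X, zero_mul, zero_add, mul_one, hkC, ← hc]
      linear_combination (3 * X ^ 3 - 27 * X ^ 2) * hC
    · simp only [ladderPoly, Nat.cast_zero, derivative_one, hkC, ← hc]
      linear_combination (135 * X + (135 * C c + 27) * X ^ 2) * hC
  | succ m ih =>
    obtain ⟨c0, c1, h1, h2⟩ := ih
    have hK := ladderCoeff_denom_pos hk m
    have hr := X_mul_ladderPoly_of_coeff_zero k m c0 c1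
    have hr : 27 * (9 * ((m : ℝ[X]) + 2) ^ 2 - C k ^ 2) * (X * ladderPoly k (m + 2)) =
      (2 * (m : ℝ[X]) + 3) * (2 * (m : ℝ[X]) + 5) *
        ((9 - X) ^ 2 * ladderPoly k m - 81 * (1 - X) * ladderPoly k (m + 1)) := by
      have e : 27 * (9 * ((m : ℝ[X]) + 2) ^ 2 - C k ^ 2) * C (ladderCoeff k m) =
          (2 * (m : ℝ[X]) + 3) * (2 * (m : ℝ[X]) + 5) := by
        have : 27 * (9 * ((m : ℝ) + 2) ^ 2 - k ^ 2) * ladderCoeff k m =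
            (2 * (m : ℝ) + 3) * (2 * (m : ℝ) + 5) := by
          rw [ladderCoeff, mul_div_cancel₀]
          positivity
        simpa only [map_mul, map_sub, map_add, map_pow, map_natCast, map_ofNat] using
          congrArg (C : ℝ →+* ℝ[X]) this
      rw [hr, ← mul_assoc, e]
    have hd := congrArg derivative hr
    have hd : 27 * (9 * ((m : ℝ[X]) + 2) ^ 2 - C k ^ 2) *
        (ladderPoly k (m + 2) + X * derivative (ladderPoly k (m + 2))) =
      (2 * (m : ℝ[X]) + 3) * (2 * (m : ℝ[X]) + 5) *
        ((9 - X) ^ 2 * derivative (ladderPoly k m) - 2 * (9 - X) * ladderPoly k m -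
          81 * (1 - X) * derivative (ladderPoly k (m + 1)) + 81 * ladderPoly k (m + 1)) := by
      simp only [derivative_mul, derivative_sub, derivative_add, derivative_pow, derivative_C,
        derivative_X, derivative_natCast, derivative_ofNat, derivative_one] at hd
      simp only [map_ofNat, Nat.cast_ofNat] at hd
      linear_combination hd
    have hL := ladder_step_aux _ _ _ _ _ _ _ _ _ h1 h2 hr hd
    have hne : 27 * (9 * ((m : ℝ[X]) + 2) ^ 2 - C k ^ 2) * X ≠ 0 := by
      refine mul_ne_zero ?_ X_ne_zero
      have : (27 * (9 * ((m : ℝ[X]) + 2) ^ 2 - C k ^ 2)) =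
          C (27 * (9 * ((m : ℝ) + 2) ^ 2 - k ^ 2)) := by
        simp only [map_mul, map_sub, map_add, map_pow, map_natCast, map_ofNat]
      rw [this, Ne, C_eq_zero]
      positivity
    have hL := mul_left_cancel₀ hne hL
    refine ⟨c1, ?_, ?_, ?_⟩
    -- At X = 0 the derivative term drops out, leaving 81(2m+5) times the difference of the two
    -- constant terms.
    · have h := congrArg (eval 0) hL
      rw [coeff_zero_eq_eval_zero] at *
      simp [c1] at h
      have hm : (2 * ((m : ℝ) + 1) + 3) ≠ 0 := by positivity
      apply mul_left_cancel₀ hm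
      linarith
    · push_cast
      exact hL
    · push_cast
      have h3 : (3 : ℝ[X]) ≠ 0 := by norm_num
      apply mul_left_cancel₀ h3
      -- The recurrence turns the term (9-X)² q_m of the first relation into q_(m+2), which is the
      -- second relation one index higher.
      linear_combination (2 * (m : ℝ[X]) + 5) * h1 - hr

theorem ladderPoly_coeff_zero {k : ℝ} (hk : (k - 1) * (k - 2) = 0) (m : ℕ) :
    (ladderPoly k m).coeff 0 = 1 :=
  (ladderPoly_derivative hk m).1

open Polynomial in
theorem X_mul_ladderPoly {k : ℝ} (hk : (k - 1) * (k - 2) = 0) (m : ℕ) :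
    X * ladderPoly k (m + 2) = C (ladderCoeff k m) *
        ((9 - X) ^ 2 * ladderPoly k m - 81 * (1 - X) * ladderPoly k (m + 1)) :=
  X_mul_ladderPoly_of_coeff_zero k m (ladderPoly_coeff_zero hk m)
    (ladderPoly_coeff_zero hk (m + 1))

/-! ### Even combinations and pivot polynomials -/

open PowerSeries

theorem two_mul_C_half : (2 : PowerSeries ℝ) * C (1 / 2) = 1 := by
  rw [← map_ofNat C 2, ← map_mul]
  norm_num

theorem oneSubX_mul_pivotVar :
    (oneSubX : PowerSeries ℝ) * pivotVar = -(C (1 / 2) * (1 + X) ^ 2) := by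
  have h1 := oneSubX_mul_fourDiv
  have h2 := two_mul_C_half
  unfold pivotVar
  rw [oneSubX_val] at *
  linear_combination -C (1 / 2) * h1 - (2 - 2 * X) * h2

theorem oneSubX_cube_mul_pivotVar : (oneSubX : PowerSeries ℝ) ^ 3 * pivotVar =
    -(C (1 / 2) * (1 - X ^ 2) ^ 2) := by
  have h := oneSubX_mul_pivotVar
  rw [oneSubX_val] at *
  linear_combination (1 - X) ^ 2 * h

theorem oneSubX_mul_one_sub_pivotVar : (oneSubX : PowerSeries ℝ) * (1 - pivotVar) =
    C (1 / 2) * (3 + X ^ 2) := by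
  have h := oneSubX_mul_pivotVar
  have h2 := two_mul_C_half
  rw [oneSubX_val] at *
  linear_combination -h - (1 - X) * h2

/-- The cubic equals -4(1-g)³ - 27g, and (3+X²)³ - 27(1-X²)² = X²(9-X²)². The factor X² is what
raises the order of the odd part. -/
theorem oneSubX_cube_mul_cubic : (oneSubX : PowerSeries ℝ) ^ 3 *
    ((pivotVar - 4) * (1 + 2 * pivotVar) ^ 2) = -(C (1 / 2) * X ^ 2 * (9 - X ^ 2) ^ 2) := by
  have h1 := oneSubX_mul_one_sub_pivotVar
  have h3 := oneSubX_cube_mul_pivotVar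
  have h2 := two_mul_C_half
  have e : (oneSubX : PowerSeries ℝ) ^ 3 * ((pivotVar - 4) * (1 + 2 * pivotVar) ^ 2) =
      -4 * ((oneSubX : PowerSeries ℝ) * (1 - pivotVar)) ^ 3 -
        27 * ((oneSubX : PowerSeries ℝ) ^ 3 * pivotVar) := by ring
  rw [e, h1, h3]
  linear_combination -(3 + X ^ 2) ^ 3 * C (1 / 2) * (2 * C (1 / 2) + 1) * h2

theorem isEvenSeries_X_sq_poly (p : Polynomial ℝ) :
    IsEvenSeries (Polynomial.aeval ((X : PowerSeries ℝ) ^ 2) p) := by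
  induction p using Polynomial.induction_on' with
  | add p q hp hq => rw [map_add]; exact hp.add hq
  | monomial n a =>
    rw [Polynomial.aeval_monomial]
    exact (IsEvenSeries.const a).mul (IsEvenSeries.X_sq.pow n)

theorem isEvenSeries_one_sub : IsEvenSeries (1 - (X : PowerSeries ℝ) ^ 2) := by
  have := isEvenSeries_X_sq_poly (1 - Polynomial.X)
  simpa using this

theorem isEvenSeries_half_sum : IsEvenSeries (C (1 / 2) * (3 + (X : PowerSeries ℝ) ^ 2)) := by
  refine (IsEvenSeries.const _).mul (IsEvenSeries.add ?_ IsEvenSeries.X_sq)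
  rw [← map_ofNat C 3]
  exact IsEvenSeries.const _

theorem IsEvenSeries.of_mul_eq_one {f g : PowerSeries ℝ} (hf : IsEvenSeries f) (h : f * g = 1) :
    IsEvenSeries g := by
  have h1 := congrArg (rescale (-1 : ℝ)) h
  rw [map_mul, hf, map_one] at h1
  unfold IsEvenSeries
  linear_combination (-rescale (-1 : ℝ) g) * h + g * h1

theorem IsEvenSeries.of_mul_left {f g : PowerSeries ℝ} (hf : IsEvenSeries f)
    (h0 : constantCoeff f ≠ 0) (h : IsEvenSeries (f * g)) : IsEvenSeries g := by
  have h1 := PowerSeries.mul_inv_cancel f h0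
  have : g = f⁻¹ * (f * g) := by linear_combination -g * h1
  rw [this]
  exact (hf.of_mul_eq_one h1).mul h

/-- A polynomial whose value at `pivotVar` eliminates the first `m` odd coefficients of the row
with index `m`. -/
structure IsPivotPoly (k m : ℕ) (p : Polynomial ℝ) (lead : ℝ) : Prop where
  natDegree_le : p.natDegree ≤ m
  coeff_eq : p.coeff m = lead
  even_sub : IsEvenSeries ((1 - X ^ 2) ^ (m + k) *
    (((oneSubX ^ (-(k : ℤ)) : (PowerSeries ℝ)ˣ) : PowerSeries ℝ) * Polynomial.aeval pivotVar p) -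
      X ^ (2 * m + 1) * Polynomial.aeval ((X : PowerSeries ℝ) ^ 2) (ladderPoly k m))

theorem one_sub_sq_mul_oneSubX_zpow_neg (k : ℕ) : (1 - (X : PowerSeries ℝ) ^ 2) ^ k *
    ((oneSubX ^ (-(k : ℤ)) : (PowerSeries ℝ)ˣ) : PowerSeries ℝ) = (1 + (X : PowerSeries ℝ)) ^ k := by
  have h : (1 - (X : PowerSeries ℝ) ^ 2) = (1 + X) * (oneSubX : PowerSeries ℝ) := by rw [oneSubX_val]; ring
  rw [h, mul_pow, mul_assoc, ← Units.val_pow_eq_pow_val, ← Units.val_mul, zpow_neg, zpow_natCast,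
    mul_inv_cancel, Units.val_one, mul_one]

/-- Dividing by the even unit (1-X²)^(m+k) shows that the odd part of the row starts at X^(2m+1)
with coefficient q_m(0) = 1. -/
theorem IsPivotPoly.baseDet_succ {k m : ℕ} {p : Polynomial ℝ} {lead : ℝ}
    (h : IsPivotPoly k m p lead) (hk : ((k : ℝ) - 1) * (k - 2) = 0) :
    lead * baseDet k (m + 1) = baseDet k m := by
  set A := ((oneSubX ^ (-(k : ℤ)) : (PowerSeries ℝ)ˣ) : PowerSeries ℝ) *
    Polynomial.aeval pivotVar p with hA
  set y : PowerSeries ℝ := (1 - X ^ 2) ^ (m + k) with hy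
  set q := Polynomial.aeval ((X : PowerSeries ℝ) ^ 2) (ladderPoly k m) with hq
  have hye : IsEvenSeries y := isEvenSeries_one_sub.pow _
  have hy1 : constantCoeff y = 1 := by simp [hy]
  have hy0 : constantCoeff y ≠ 0 := by simp [hy1]
  have hyy := PowerSeries.mul_inv_cancel y hy0
  have hE : IsEvenSeries (A - X ^ (2 * m + 1) * (y⁻¹ * q)) := by
    refine hye.of_mul_left hy0 ?_
    have : y * (A - X ^ (2 * m + 1) * (y⁻¹ * q)) = y * A - X ^ (2 * m + 1) * q := by
      linear_combination -(X ^ (2 * m + 1) * q) * hyy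
    rw [this]
    exact h.even_sub
  have hc : ∀ j, coeff (2 * j + 1) A = coeff (2 * j + 1) (X ^ (2 * m + 1) * (y⁻¹ * q)) := by
    intro j
    have := hE.coeff_eq_zero j
    rwa [map_sub, sub_eq_zero] at this
  have hq1 : constantCoeff q = 1 := by
    have h0 := ladderPoly_coeff_zero hk m
    rw [hq, ← PowerSeries.coeff_zero_eq_constantCoeff_apply,
      Polynomial.aeval_eq_sum_range, map_sum, Finset.sum_range_succ', Finset.sum_eq_zero]
    · simp [h0]
    · intro i _
      simp
  have key := oddDet_pow_succ ((oneSubX ^ (-(k : ℤ)) : (PowerSeries ℝ)ˣ) : PowerSeries ℝ)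
    pivotVar m p h.natDegree_le (by
      intro j hj
      rw [← hA, hc, PowerSeries.coeff_X_pow_mul', if_neg (by omega)])
  rw [← hA, hc, PowerSeries.coeff_X_pow_mul', if_pos le_rfl, h.coeff_eq] at key
  simpa [baseDet, hy1, hq1] using key

/-- The new polynomial is β((cubic · p + c(1-g)^(3-k))/g - 81q), mirroring the recurrence of
`ladderPoly`. The correction term is invisible, since v^(3-k)(1-g)^(3-k) is even. -/
theorem IsPivotPoly.step {k m : ℕ} {p q : Polynomial ℝ} {a b : ℝ} (hp : IsPivotPoly k m p a)
    (hq : IsPivotPoly k (m + 1) q b) (hk : ((k : ℝ) - 1) * (k - 2) = 0) (hk1 : 1 ≤ k) (hk2 : k ≤ 2) :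
    ∃ r, IsPivotPoly k (m + 2) r (4 * ladderCoeff k m * a) := by
  set β := ladderCoeff k m with hβ
  -- The cubic is -4 at 0, so this c makes s divisible by the variable.
  set c : ℝ := 4 * p.coeff 0 with hc
  set s : Polynomial ℝ := (Polynomial.X - 4) * (1 + 2 * Polynomial.X) ^ 2 * p +
    Polynomial.C c * (1 - Polynomial.X) ^ (3 - k) with hs
  have hs0 : s.coeff 0 = 0 := by
    rw [Polynomial.coeff_zero_eq_eval_zero, hs]
    simp [hc, Polynomial.coeff_zero_eq_eval_zero]
  have hsX : Polynomial.X * s.divX = s := by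
    have := Polynomial.X_mul_divX_add s
    rwa [hs0, map_zero, add_zero] at this
  have hcubic : ((Polynomial.X - 4) * (1 + 2 * Polynomial.X) ^ 2 : Polynomial ℝ).natDegree ≤ 3 := by
    compute_degree
  have hcubic3 : ((Polynomial.X - 4) * (1 + 2 * Polynomial.X) ^ 2 : Polynomial ℝ).coeff 3 = 4 := by
    compute_degree!
  have hlow : ((1 - Polynomial.X) ^ (3 - k) : Polynomial ℝ).natDegree ≤ 2 := by
    refine Polynomial.natDegree_pow_le.trans ?_
    have : (1 - Polynomial.X : Polynomial ℝ).natDegree ≤ 1 := by compute_degree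
    calc _ ≤ (3 - k) * 1 := Nat.mul_le_mul_left _ this
      _ ≤ 2 := by omega
  have hsdeg : s.natDegree ≤ m + 3 := by
    refine (Polynomial.natDegree_add_le _ _).trans (max_le ?_ ?_)
    · exact (Polynomial.natDegree_mul_le.trans (add_le_add hcubic hp.natDegree_le)).trans
        (by omega)
    · exact ((Polynomial.natDegree_C_mul_le _ _).trans hlow).trans (by omega)
  have hscoeff : s.coeff (m + 3) = 4 * a := by
    rw [hs, Polynomial.coeff_add, Polynomial.coeff_C_mul,
      Polynomial.coeff_eq_zero_of_natDegree_lt (hlow.trans_lt (by omega : 2 < m + 3)), mul_zero,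
      add_zero, add_comm m 3, Polynomial.coeff_mul_add_eq_of_natDegree_le hcubic hp.natDegree_le,
      hcubic3, hp.coeff_eq]
  refine ⟨Polynomial.C (-81 * β) * q + Polynomial.C β * s.divX, ?_, ?_, ?_⟩
  · refine (Polynomial.natDegree_add_le _ _).trans (max_le ?_ ?_)
    · exact ((Polynomial.natDegree_C_mul_le _ _).trans hq.natDegree_le).trans (by omega)
    · refine (Polynomial.natDegree_C_mul_le _ _).trans ?_
      rw [Polynomial.natDegree_divX_eq_natDegree_tsub_one]
      omega
  · rw [Polynomial.coeff_add, Polynomial.coeff_C_mul, Polynomial.coeff_C_mul, Polynomial.coeff_divX,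
      hscoeff, Polynomial.coeff_eq_zero_of_natDegree_lt
        (hq.natDegree_le.trans_lt (by omega : m + 1 < m + 2))]
    ring
  · set V := ((oneSubX ^ (-(k : ℤ)) : (PowerSeries ℝ)ˣ) : PowerSeries ℝ) with hV
    set v := (oneSubX : PowerSeries ℝ) with hv
    set g := pivotVar with hg
    set P0 := Polynomial.aeval g p with hP0
    set P1 := Polynomial.aeval g q with hP1
    set D := Polynomial.aeval g s.divX with hD
    have hgD : g * D = (g - 4) * (1 + 2 * g) ^ 2 * P0 + C c * (1 - g) ^ (3 - k) := by
      have := congrArg (Polynomial.aeval g) hsX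
      rw [map_mul, Polynomial.aeval_X] at this
      rw [hD, this, hs]
      simp only [map_add, map_mul, map_sub, map_pow, Polynomial.aeval_X, map_one, map_ofNat,
        Polynomial.aeval_C]
      rfl
    have hvV : v ^ 3 * V * (1 - g) ^ (3 - k) = (C (1 / 2) * (3 + X ^ 2)) ^ (3 - k) := by
      rw [← oneSubX_mul_one_sub_pivotVar, mul_pow]
      congr 1
      rw [hv, hV, ← Units.val_pow_eq_pow_val, ← Units.val_pow_eq_pow_val, ← Units.val_mul,
        zpow_neg, zpow_natCast, pow_sub _ (by omega : k ≤ 3)]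
    have h3 := oneSubX_cube_mul_pivotVar
    have hc3 := oneSubX_cube_mul_cubic
    have h2 := two_mul_C_half
    have hladder := congrArg (Polynomial.aeval ((X : PowerSeries ℝ) ^ 2)) (X_mul_ladderPoly hk m)
    simp only [map_mul, map_sub, map_pow, Polynomial.aeval_X, map_one, map_ofNat,
      Polynomial.aeval_C] at hladder
    set q0 := Polynomial.aeval ((X : PowerSeries ℝ) ^ 2) (ladderPoly k m)
    set q1 := Polynomial.aeval ((X : PowerSeries ℝ) ^ 2) (ladderPoly k (m + 1))
    set q2 := Polynomial.aeval ((X : PowerSeries ℝ) ^ 2) (ladderPoly k (m + 2))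
    have hB : algebraMap ℝ (PowerSeries ℝ) (ladderCoeff k m) = C β := rfl
    rw [hB] at hladder
    have hR : Polynomial.aeval g (Polynomial.C (-81 * β) * q + Polynomial.C β * s.divX) =
        -81 * C β * P1 + C β * D := by
      simp only [map_add, map_mul, Polynomial.aeval_C, ← hP1, ← hD]
      congr 2
      have : algebraMap ℝ (PowerSeries ℝ) (-81) = -81 := by
        rw [map_neg, map_ofNat]
      rw [this]; rfl
    rw [hR]
    have e0 := hp.even_sub
    have e1 := hq.even_sub
    set y : PowerSeries ℝ := 1 - X ^ 2 with hy
    have hye : IsEvenSeries y := isEvenSeries_one_sub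
    -- The extra (1-X²)² equals -2v³g, and its factor g undoes the division by g.
    refine (hye.pow 2).of_mul_left (by simp [hy]) ?_
    have hE : IsEvenSeries (C (-2 * β) * (y ^ (m + 2 + k) * (C c *
        (C (1 / 2) * (3 + X ^ 2)) ^ (3 - k))) +
        C (-81 * β) * (y ^ 3 * (y ^ (m + 1 + k) * (V * P1) - X ^ (2 * (m + 1) + 1) * q1)) +
        C β * (y ^ 2 * (X ^ 2 * ((9 - X ^ 2) ^ 2 *
          (y ^ (m + k) * (V * P0) - X ^ (2 * m + 1) * q0))))) := by
      have h9 : IsEvenSeries (9 - (X : PowerSeries ℝ) ^ 2) := by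
        rw [← map_ofNat C 9]
        exact (IsEvenSeries.const 9).sub IsEvenSeries.X_sq
      refine ((((IsEvenSeries.const _).mul ((hye.pow _).mul ((IsEvenSeries.const _).mul
        (isEvenSeries_half_sum.pow _))))).add ((IsEvenSeries.const _).mul
        ((hye.pow 3).mul e1))).add ((IsEvenSeries.const _).mul ((hye.pow 2).mul
        (IsEvenSeries.X_sq.mul ((h9.pow 2).mul e0))))
    convert hE using 1
    rw [hv] at *
    simp only [map_mul, map_neg, map_ofNat]
    rw [← hvV]
    linear_combination -(y ^ (m + 2 + k) * V * C β * D) * y ^ 2 * h2 +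
      2 * (y ^ (m + 2 + k) * V * C β * D) * h3 - 2 * v ^ 3 * C β * y ^ (m + 2 + k) * V * hgD -
      2 * C β * y ^ (m + 2 + k) * V * P0 * hc3 +
      C β * y ^ (m + 2 + k) * V * P0 * X ^ 2 * (9 - X ^ 2) ^ 2 * h2 -
      y ^ 2 * X ^ (2 * m + 3) * hladder

theorem isEvenSeries_of_ofNat_mul {f : PowerSeries ℝ} (n : ℕ) [n.AtLeastTwo]
    (h : IsEvenSeries ((OfNat.ofNat n : PowerSeries ℝ) * f)) : IsEvenSeries f := by
  rw [← map_ofNat C n] at h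
  exact (IsEvenSeries.const _).of_mul_left (by simp) h

theorem isEvenSeries_quartic (a b c : ℤ) :
    IsEvenSeries ((a : PowerSeries ℝ) + (b : PowerSeries ℝ) * X ^ 2 + (c : PowerSeries ℝ) * X ^ 4) := by
  have := isEvenSeries_X_sq_poly ((a : Polynomial ℝ) +
    (b : Polynomial ℝ) * Polynomial.X + (c : Polynomial ℝ) * Polynomial.X ^ 2)
  simp only [map_add, map_mul, map_pow, Polynomial.aeval_X, map_intCast] at this
  convert this using 2
  ring

theorem isPivotPoly_one_zero : IsPivotPoly 1 0 1 1 := by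
  refine ⟨by simp, by simp, ?_⟩
  rw [← mul_assoc, zero_add, one_sub_sq_mul_oneSubX_zpow_neg]
  have := IsEvenSeries.const 1
  simpa [ladderPoly] using this

theorem isPivotPoly_two_zero : IsPivotPoly 2 0 (Polynomial.C (1 / 2)) (1 / 2) := by
  refine ⟨by simp, by simp, ?_⟩
  rw [← mul_assoc, zero_add, one_sub_sq_mul_oneSubX_zpow_neg]
  refine isEvenSeries_of_ofNat_mul 2 ?_
  have h := isEvenSeries_quartic 1 1 0
  have h2 := two_mul_C_half
  have e : Polynomial.aeval pivotVar (Polynomial.C (1 / 2 : ℝ)) = C (1 / 2) := by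
    rw [Polynomial.aeval_C]; rfl
  rw [e, ladderPoly, map_one]
  convert h using 1
  push_cast
  linear_combination (1 + X) ^ 2 * h2

theorem one_sub_sq_mul_aeval_linear (k : ℕ) (a b : ℝ) : (1 - (X : PowerSeries ℝ) ^ 2) ^ (1 + k) *
    (((oneSubX ^ (-(k : ℤ)) : (PowerSeries ℝ)ˣ) : PowerSeries ℝ) *
      Polynomial.aeval pivotVar (Polynomial.C a + Polynomial.C b * Polynomial.X)) =
    (1 + X) ^ k * ((1 - X ^ 2) * C a - C b * C (1 / 2) * (1 + X) ^ 3) := by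
  have h := oneSubX_mul_pivotVar
  rw [oneSubX_val] at h
  have e : Polynomial.aeval pivotVar (Polynomial.C a + Polynomial.C b * Polynomial.X) =
      C a + C b * pivotVar := by
    rw [map_add, map_mul, Polynomial.aeval_C, Polynomial.aeval_C, Polynomial.aeval_X]; rfl
  rw [← one_sub_sq_mul_oneSubX_zpow_neg, e]
  linear_combination (1 - X ^ 2) ^ k *
    ((oneSubX ^ (-(k : ℤ)) : (PowerSeries ℝ)ˣ) : PowerSeries ℝ) * C b * (1 + X) * h

/-- The two coefficients are forced: X must cancel and X³ must have coefficient 1. After scaling by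
8 the even remainder is -3 + 10X² + X⁴. -/
theorem isPivotPoly_one_one : IsPivotPoly 1 1
    (Polynomial.C (-(1 / 2)) + Polynomial.C (-(1 / 4)) * Polynomial.X) (-(1 / 4)) := by
  refine ⟨by compute_degree, by simp [Polynomial.coeff_C], ?_⟩
  rw [one_sub_sq_mul_aeval_linear]
  refine isEvenSeries_of_ofNat_mul 8 ?_
  have h := isEvenSeries_quartic (-3) 10 1
  have h1 : (8 : PowerSeries ℝ) * C (-(1 / 2)) = -4 := by
    rw [← map_ofNat C 8, ← map_mul, ← map_ofNat C 4, ← map_neg]; norm_num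
  have h2 : (8 : PowerSeries ℝ) * (C (-(1 / 4)) * C (1 / 2)) = -1 := by
    rw [← map_ofNat C 8, ← map_mul, ← map_mul, ← map_one C, ← map_neg]; norm_num
  have e : Polynomial.aeval ((X : PowerSeries ℝ) ^ 2) (ladderPoly ((1 : ℕ) : ℝ) 1) = 1 := by
    simp [ladderPoly]
  rw [e]
  convert h using 1
  push_cast
  linear_combination (1 + X) * (1 - X ^ 2) * h1 - (1 + X) ^ 4 * h2

/-- As for k = 1, but a term X⁵/15 survives; it accounts for the coefficient (k-1)/15 in
`ladderPoly`. -/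
theorem isPivotPoly_two_one : IsPivotPoly 2 1
    (Polynomial.C (-(1 / 6)) + Polynomial.C (-(2 / 15)) * Polynomial.X) (-(2 / 15)) := by
  refine ⟨by compute_degree, by simp [Polynomial.coeff_C], ?_⟩
  rw [one_sub_sq_mul_aeval_linear]
  refine isEvenSeries_of_ofNat_mul 30 ?_
  have h := isEvenSeries_quartic (-3) 20 15
  have h1 : (30 : PowerSeries ℝ) * C (-(1 / 6)) = -5 := by
    rw [← map_ofNat C 30, ← map_mul, ← map_ofNat C 5, ← map_neg]; norm_num
  have h2 : (30 : PowerSeries ℝ) * (C (-(2 / 15)) * C (1 / 2)) = -2 := by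
    rw [← map_ofNat C 30, ← map_mul, ← map_mul, ← map_ofNat C 2, ← map_neg]; norm_num
  have h3 : (15 : PowerSeries ℝ) * C (1 / 15) = 1 := by
    rw [← map_ofNat C 15, ← map_mul, ← map_one C]; norm_num
  have e : Polynomial.aeval ((X : PowerSeries ℝ) ^ 2) (ladderPoly ((2 : ℕ) : ℝ) 1) =
      1 + C (1 / 15) * X ^ 2 := by
    rw [ladderPoly, map_add, map_mul, Polynomial.aeval_C, Polynomial.aeval_X, map_one]
    norm_num
  rw [e]
  convert h using 1
  push_cast
  linear_combination (1 + X) ^ 2 * (1 - X ^ 2) * h1 - (1 + X) ^ 5 * h2 - 2 * X ^ 5 * h3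

/-- The leading coefficients of the pivot polynomials. -/
noncomputable def pivotLead (k : ℕ) (a b : ℝ) : ℕ → ℝ
  | 0 => a
  | 1 => b
  | m + 2 => 4 * ladderCoeff k m * pivotLead k a b m

theorem exists_isPivotPoly {k : ℕ} {p q : Polynomial ℝ} {a b : ℝ} (hp : IsPivotPoly k 0 p a)
    (hq : IsPivotPoly k 1 q b) (hk : ((k : ℝ) - 1) * (k - 2) = 0) (hk1 : 1 ≤ k) (hk2 : k ≤ 2)
    (m : ℕ) : ∃ r, IsPivotPoly k m r (pivotLead k a b m) := by
  induction m using Nat.twoStepInduction with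
  | zero => exact ⟨p, hp⟩
  | one => exact ⟨q, hq⟩
  | more m h1 h2 =>
    obtain ⟨r, hr⟩ := h1
    obtain ⟨s, hs⟩ := h2
    exact hr.step hs hk hk1 hk2

theorem pivotLead_mul_baseDet_one (m : ℕ) :
    pivotLead 1 1 (-(1 / 4)) m * baseDet 1 (m + 1) = baseDet 1 m := by
  obtain ⟨r, hr⟩ := exists_isPivotPoly isPivotPoly_one_zero isPivotPoly_one_one (by norm_num)
    le_rfl (by norm_num) m
  exact hr.baseDet_succ (by norm_num)

theorem pivotLead_mul_baseDet_two (m : ℕ) :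
    pivotLead 2 (1 / 2) (-(2 / 15)) m * baseDet 2 (m + 1) = baseDet 2 m := by
  obtain ⟨r, hr⟩ := exists_isPivotPoly isPivotPoly_two_zero isPivotPoly_two_one (by norm_num)
    (by norm_num) le_rfl m
  exact hr.baseDet_succ (by norm_num)

/-! ### Reduction of shifted rows modulo even series -/

theorem det_coeff_succ_of_first (a : ℕ) (f : ℕ → PowerSeries ℝ) (n : ℕ)
    (hf : ∀ j, 1 ≤ j → coeff (2 * j + a) (f 0) = 0) :
    Matrix.det (Matrix.of fun i j : Fin (n + 1) => coeff (2 * (j : ℕ) + a) (f i)) =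
      coeff a (f 0) *
      Matrix.det (Matrix.of fun i j : Fin n => coeff (2 * (j : ℕ) + (a + 2)) (f (i + 1))) := by
  rw [Matrix.det_succ_row_zero, Finset.sum_eq_single 0]
  · simp only [Fin.val_zero, Matrix.of_apply, pow_zero, one_mul, mul_zero, zero_add]
    congr 2
    ext i j
    simp only [Matrix.submatrix_apply, Matrix.of_apply, Fin.val_succ, Fin.succAbove_zero]
    congr 2
    ring
  · intro j _ hj
    have : 1 ≤ (j : ℕ) := Fin.pos_iff_ne_zero.2 hj
    simp [hf j this]
  · simp

theorem oddDet_add_smul_first {f g : ℕ → PowerSeries ℝ} {n : ℕ} (c : ℝ)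
    (h0 : g 0 = f 0 + c • f 1) (h : ∀ i, g (i + 1) = f (i + 1)) :
    oddDet g (n + 2) = oddDet f (n + 2) := by
  unfold oddDet
  rw [← Matrix.det_updateRow_add_smul_self
    (Matrix.of fun i j : Fin (n + 2) => coeff (2 * (j : ℕ) + 1) (f i)) Fin.zero_ne_one c]
  congr 1
  ext i j
  rcases Fin.eq_zero_or_eq_succ i with rfl | ⟨i, rfl⟩
  · simp [h0]
  · rw [Matrix.updateRow_ne (Fin.succ_ne_zero i)]
    simp [h]

theorem oneSubX_pow_mul_zpow (a k : ℕ) (h : k ≤ a) : (oneSubX : PowerSeries ℝ) ^ a *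
    ((oneSubX ^ (-(k : ℤ)) : (PowerSeries ℝ)ˣ) : PowerSeries ℝ) =
      (oneSubX : PowerSeries ℝ) ^ (a - k) := by
  rw [← Units.val_pow_eq_pow_val, ← Units.val_pow_eq_pow_val, ← Units.val_mul,
    zpow_neg, zpow_natCast, pow_sub _ h]

/-- Division by `X` after subtracting a multiple of `(1 - X) ^ e`. -/
noncomputable def reduceStep (e : ℕ) (q : Polynomial ℝ) : Polynomial ℝ :=
  (q - Polynomial.C (q.coeff 0) * (1 - Polynomial.X) ^ e).divX

theorem X_mul_reduceStep (e : ℕ) (q : Polynomial ℝ) : q =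
    Polynomial.X * reduceStep e q + Polynomial.C (q.coeff 0) * (1 - Polynomial.X) ^ e := by
  have h : (q - Polynomial.C (q.coeff 0) * (1 - Polynomial.X) ^ e).coeff 0 = 0 := by
    rw [Polynomial.coeff_zero_eq_eval_zero]
    simp [Polynomial.coeff_zero_eq_eval_zero]
  have := Polynomial.X_mul_divX_add (q - Polynomial.C (q.coeff 0) * (1 - Polynomial.X) ^ e)
  rw [h, map_zero, add_zero] at this
  rw [reduceStep, this]
  ring

theorem coeff_one_sub_X_pow (e j : ℕ) :
    ((1 - Polynomial.X : Polynomial ℝ) ^ e).coeff j = (-1) ^ j * (e.choose j : ℝ) := by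
  have h : (1 - Polynomial.X : Polynomial ℝ) ^ e =
      ((1 + Polynomial.X) ^ e).comp (Polynomial.C (-1) * Polynomial.X) := by
    simp [sub_eq_add_neg]
  rw [h, Polynomial.comp_C_mul_X_coeff, Polynomial.coeff_one_add_X_pow, mul_comm]

theorem reduceStep_coeff (e : ℕ) (q : Polynomial ℝ) (j : ℕ) : (reduceStep e q).coeff j =
    q.coeff (j + 1) - q.coeff 0 * ((-1) ^ (j + 1) * (e.choose (j + 1) : ℝ)) := by
  rw [reduceStep, Polynomial.coeff_divX, Polynomial.coeff_sub, Polynomial.coeff_C_mul,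
    coeff_one_sub_X_pow]

theorem reduceStep_natDegree_le {e d : ℕ} {q : Polynomial ℝ} (hq : q.natDegree ≤ d + 1)
    (he : e ≤ d + 1) : (reduceStep e q).natDegree ≤ d := by
  rw [Polynomial.natDegree_le_iff_coeff_eq_zero]
  intro j hj
  rw [reduceStep_coeff, Polynomial.coeff_eq_zero_of_natDegree_lt (by omega),
    Nat.choose_eq_zero_of_lt (by omega)]
  simp

/-- Iterated `reduceStep` with exponents `3 m - k, …, 6 - k, 3 - k`. -/
noncomputable def reduce (k : ℕ) : ℕ → Polynomial ℝ → Polynomial ℝ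
  | 0, q => q
  | m + 1, q => reduce k m (reduceStep (3 * (m + 1) - k) q)

theorem reduce_natDegree_le (k d : ℕ) (m : ℕ) (q : Polynomial ℝ) (hq : q.natDegree ≤ d + m)
    (h : 2 * m ≤ d + k) : (reduce k m q).natDegree ≤ d := by
  induction m generalizing q with
  | zero => exact hq
  | succ m ih =>
    exact ih _ (reduceStep_natDegree_le hq (by omega)) (by omega)

/-- Under the strict inequality each subtracted power of 1 - X has degree too small to reach the top
coefficient. -/
theorem reduce_coeff_top (k d : ℕ) (m : ℕ) (q : Polynomial ℝ) (h : 2 * m < d + k) :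
    (reduce k m q).coeff d = q.coeff (d + m) := by
  induction m generalizing q with
  | zero => rfl
  | succ m ih =>
    rw [reduce, ih _ (by omega), reduceStep_coeff, Nat.choose_eq_zero_of_lt (by omega)]
    simp [add_assoc]

theorem constantCoeff_oneSubX_cube_mul_pivotVar :
    constantCoeff ((oneSubX : PowerSeries ℝ) ^ 3 * pivotVar) = -(1 / 2) := by
  rw [oneSubX_cube_mul_pivotVar]
  simp

theorem isEvenSeries_oneSubX_cube_mul_pivotVar :
    IsEvenSeries ((oneSubX : PowerSeries ℝ) ^ 3 * pivotVar) := by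
  rw [oneSubX_cube_mul_pivotVar, neg_mul_eq_neg_mul, ← map_neg]
  exact (IsEvenSeries.const _).mul (isEvenSeries_one_sub.pow 2)

/-- Each step writes q = g·q' + q(0)(1-g)^(3m-k). Multiplied by v^(3m-k), the second term is a
constant times a power of v(1-g), hence even; the first releases a factor v³g. -/
theorem isEvenSeries_sub_reduce (k : ℕ) (hk : k ≤ 3) (m : ℕ) (q : Polynomial ℝ) :
    IsEvenSeries ((oneSubX : PowerSeries ℝ) ^ (3 * m) *
      ((oneSubX ^ (-(k : ℤ)) : (PowerSeries ℝ)ˣ) : PowerSeries ℝ) * Polynomial.aeval pivotVar q -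
      ((oneSubX : PowerSeries ℝ) ^ 3 * pivotVar) ^ m *
      (((oneSubX ^ (-(k : ℤ)) : (PowerSeries ℝ)ˣ) : PowerSeries ℝ) *
        Polynomial.aeval pivotVar (reduce k m q))) := by
  induction m generalizing q with
  | zero =>
    have := IsEvenSeries.const 0
    simpa [reduce] using this
  | succ m ih =>
    have h1 := ih (reduceStep (3 * (m + 1) - k) q)
    have h2 := oneSubX_pow_mul_zpow (3 * (m + 1)) k (by omega)
    have h3 := isEvenSeries_oneSubX_cube_mul_pivotVar
    have h4 : IsEvenSeries (((oneSubX : PowerSeries ℝ) * (1 - pivotVar)) ^ (3 * (m + 1) - k)) := by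
      rw [oneSubX_mul_one_sub_pivotVar]
      exact isEvenSeries_half_sum.pow _
    have h5 := congrArg (Polynomial.aeval pivotVar) (X_mul_reduceStep (3 * (m + 1) - k) q)
    simp only [map_add, map_mul, map_sub, map_pow, Polynomial.aeval_X, map_one,
        Polynomial.aeval_C] at h5
    have h6 : algebraMap ℝ (PowerSeries ℝ) (q.coeff 0) = C (q.coeff 0) := rfl
    rw [h6] at h5
    have h7 := (h3.mul h1).add ((IsEvenSeries.const (q.coeff 0)).mul h4)
    convert h7 using 1
    rw [mul_pow (oneSubX : PowerSeries ℝ) (1 - pivotVar), ← h2, h5, reduce]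
    ring

theorem powerSum_coeff_of_pos {i : ℕ} (hi : 1 ≤ i) : (powerSum i).coeff i = (-2) ^ i := by
  obtain ⟨i, rfl⟩ := Nat.exists_eq_add_of_le' hi
  exact powerSum_coeff_succ i

theorem reduce_powerSum_natDegree_le {k m : ℕ} (hm : 2 * m ≤ 3 + k) (i : ℕ) :
    (reduce k m (powerSum (i + m))).natDegree ≤ max i 3 :=
  reduce_natDegree_le k _ m _ ((powerSum_natDegree_le _).trans (by omega)) (by omega)

/-- Here 128 is `coeffDet powerSum 4`. Beyond size 4 each new diagonal entry is (-2)^(n+m) against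
(-2)^n, and (-1/2)^m absorbs the quotient. -/
theorem coeffDet_reduce {k m : ℕ} (hm : 2 * m ≤ 3 + k) {c : ℝ}
    (hc : (-(1 / 2)) ^ (m * 4) * coeffDet (fun i => reduce k m (powerSum (i + m))) 4 = c * 128)
    {n : ℕ} (hn : 4 ≤ n) :
    (-(1 / 2)) ^ (m * n) * coeffDet (fun i => reduce k m (powerSum (i + m))) n =
      c * coeffDet powerSum n := by
  induction n, hn using Nat.le_induction with
  | base =>
    rw [hc, coeffDet_powerSum_succ]
    norm_num [Finset.prod_range_succ]
  | succ n hn ih =>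
    rw [coeffDet_succ, coeffDet_succ, ← mul_assoc c, ← ih, reduce_coeff_top _ _ _ _ (by omega),
      powerSum_coeff_of_pos (by omega), powerSum_coeff_of_pos (by omega), Nat.mul_succ, pow_add,
      pow_add]
    · have : (-(1 / 2) : ℝ) ^ m * (-2) ^ m = 1 := by
        rw [← mul_pow]; norm_num
      linear_combination (-(1 / 2)) ^ (m * n) *
        coeffDet (fun i => reduce k m (powerSum (i + m))) n * (-2) ^ n * this
    · intro i hi
      exact Polynomial.coeff_eq_zero_of_natDegree_lt ((powerSum_natDegree_le i).trans_lt hi)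
    · intro i hi
      exact Polynomial.coeff_eq_zero_of_natDegree_lt
        ((reduce_powerSum_natDegree_le hm i).trans_lt (by omega))

/-- Shifting the rows by `m` while multiplying by `(1 - X) ^ (3 m)` changes the determinant by a
factor that does not depend on its size, once this is at least `4`. -/
theorem detF_shift {k m : ℕ} (hk : k ≤ 3) (hm : 2 * m ≤ 3 + k) {c : ℝ}
    (hc : (-(1 / 2)) ^ (m * 4) * coeffDet (fun i => reduce k m (powerSum (i + m))) 4 = c * 128)
    {γ δ : ℝ} (hγ : γ = k - 2 * m) (hδ : δ = k - 4 * m) {n : ℕ} (hn : 4 ≤ n) :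
    detF 1 m γ δ n = c * detF 1 0 k k n := by
  have h := detF_eq 1 m (3 * m - k) γ δ n (by push_cast; linarith) (by push_cast; linarith)
  rw [Nat.cast_one] at h
  rw [h, detF_one_zero, ← mul_assoc, ← coeffDet_reduce hm hc hn]
  have h1 : ∀ i, rowSeries (3 * m - k) (i + m) = (oneSubX : PowerSeries ℝ) ^ (3 * m) *
      ((oneSubX ^ (-(k : ℤ)) : (PowerSeries ℝ)ˣ) : PowerSeries ℝ) *
        Polynomial.aeval pivotVar (powerSum (i + m)) := by
    intro i
    rw [rowSeries_eq_aeval, sub_eq_add_neg, zpow_add, Units.val_mul]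
    congr 2
  have h2 : Matrix.det (Matrix.of fun i j : Fin n =>
      coeff (2 * (j : ℕ) + 1) (rowSeries (3 * m - k) (i + m))) =
      oddDet (fun i => rowSeries (3 * m - k) (i + m)) n := rfl
  rw [h2, oddDet_congr (g := fun i => ((oneSubX : PowerSeries ℝ) ^ 3 * pivotVar) ^ m *
      (((oneSubX ^ (-(k : ℤ)) : (PowerSeries ℝ)ˣ) : PowerSeries ℝ) *
        Polynomial.aeval pivotVar (reduce k m (powerSum (i + m)))))
      (fun i _ => by rw [h1]; exact isEvenSeries_sub_reduce k hk m _),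
    oddDet_even_mul (isEvenSeries_oneSubX_cube_mul_pivotVar.pow m), map_pow,
    constantCoeff_oneSubX_cube_mul_pivotVar, ← pow_mul, oddDet_aeval, baseDet, mul_assoc]
  intro i hi
  exact (reduce_powerSum_natDegree_le hm i).trans_lt (by omega)

/-! ### Integer evaluation of the 4 × 4 blocks -/

/-- The integer coefficients of `powerSum i`. -/
def powerSumCoeff : ℕ → ℕ → ℤ
  | 0, j => if j = 0 then 2 else 0
  | 1, j => if j = 0 then 4 else if j = 1 then -2 else 0
  | i + 2, j => 4 * powerSumCoeff (i + 1) j -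
      2 * (if j = 0 then 0 else powerSumCoeff (i + 1) (j - 1)) - 4 * powerSumCoeff i j

/-- The effect of `reduce` on integer coefficients. -/
def reduceCoeff (k : ℕ) : ℕ → (ℕ → ℤ) → ℕ → ℤ
  | 0, q => q
  | m + 1, q => reduceCoeff k m fun j =>
      q (j + 1) - q 0 * ((-1) ^ (j + 1) * ((3 * (m + 1) - k).choose (j + 1) : ℤ))

theorem powerSum_coeff (i j : ℕ) : (powerSum i).coeff j = (powerSumCoeff i j : ℝ) := by
  induction i using Nat.twoStepInduction generalizing j with
  | zero =>
    have : powerSum 0 = Polynomial.C 2 := by rw [powerSum]; rfl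
    rw [this, Polynomial.coeff_C, powerSumCoeff]
    split_ifs <;> simp
  | one =>
    have : powerSum 1 = Polynomial.C 4 - Polynomial.C 2 * Polynomial.X := by rw [powerSum]; rfl
    rw [this, Polynomial.coeff_sub, Polynomial.coeff_C, Polynomial.coeff_C_mul,
      Polynomial.coeff_X, powerSumCoeff]
    rcases j with _ | _ | j <;> simp
  | more i h1 h2 =>
    have e : powerSum (i + 1 + 1) = Polynomial.C 4 * powerSum (i + 1) -
        Polynomial.C 2 * (Polynomial.X * powerSum (i + 1)) - Polynomial.C 4 * powerSum i := by
      rw [powerSum]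
      simp only [map_ofNat]
      ring
    rw [e, Polynomial.coeff_sub, Polynomial.coeff_sub, Polynomial.coeff_C_mul,
      Polynomial.coeff_C_mul, Polynomial.coeff_C_mul, h1, h2, powerSumCoeff]
    rcases j with _ | j
    · simp
    · rw [Polynomial.coeff_X_mul, h2]
      simp

theorem reduce_coeff (k m : ℕ) (q : Polynomial ℝ) (c : ℕ → ℤ) (h : ∀ j, q.coeff j = (c j : ℝ))
    (j : ℕ) : (reduce k m q).coeff j = (reduceCoeff k m c j : ℝ) := by
  induction m generalizing q c with
  | zero => exact h j
  | succ m ih =>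
    refine ih _ _ fun j => ?_
    rw [reduceStep_coeff, h, h]
    push_cast
    rfl

theorem coeffDet_reduce_powerSum (k m n : ℕ) :
    coeffDet (fun i => reduce k m (powerSum (i + m))) n =
      ((Matrix.det (Matrix.of fun i j : Fin n =>
        reduceCoeff k m (powerSumCoeff (i + m)) j) : ℤ) : ℝ) := by
  rw [coeffDet, Int.cast_det]
  congr 1
  ext i j
  simp [reduce_coeff k m _ _ (powerSum_coeff (i + m))]

theorem det_reduceCoeff_one_one : Matrix.det (Matrix.of fun i j : Fin 4 =>
    reduceCoeff 1 1 (powerSumCoeff (i + 1)) j) = 3072 := by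
  have h : (Matrix.of fun i j : Fin 4 => reduceCoeff 1 1 (powerSumCoeff (i + 1)) j) =
      !![6, -4, 0, 0; 0, -4, 0, 0; -40, 32, -8, 0; -192, 288, -128, 16] := by
    ext i j
    fin_cases i <;> fin_cases j <;> rfl
  rw [h]
  simp [Matrix.det_succ_row_zero, Fin.sum_univ_succ, Fin.succAbove]

theorem det_reduceCoeff_one_two : Matrix.det (Matrix.of fun i j : Fin 4 =>
    reduceCoeff 1 2 (powerSumCoeff (i + 2)) j) = 688128 := by
  have h : (Matrix.of fun i j : Fin 4 => reduceCoeff 1 2 (powerSumCoeff (i + 2)) j) =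
      !![-28, 56, -40, 8; -96, 144, -80, 16; -192, 288, -144, 32; 0, 0, 0, 32] := by
    ext i j
    fin_cases i <;> fin_cases j <;> rfl
  rw [h]
  simp [Matrix.det_succ_row_zero, Fin.sum_univ_succ, Fin.succAbove]

theorem det_reduceCoeff_two_one : Matrix.det (Matrix.of fun i j : Fin 4 =>
    reduceCoeff 2 1 (powerSumCoeff (i + 1)) j) = -1024 := by
  have h : (Matrix.of fun i j : Fin 4 => reduceCoeff 2 1 (powerSumCoeff (i + 1)) j) =
      !![2, 0, 0, 0; -8, 4, 0, 0; -56, 48, -8, 0; -224, 320, -128, 16] := by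
    ext i j
    fin_cases i <;> fin_cases j <;> rfl
  rw [h]
  simp [Matrix.det_succ_row_zero, Fin.sum_univ_succ, Fin.succAbove]

theorem det_reduceCoeff_two_two : Matrix.det (Matrix.of fun i j : Fin 4 =>
    reduceCoeff 2 2 (powerSumCoeff (i + 2)) j) = 114688 := by
  have h : (Matrix.of fun i j : Fin 4 => reduceCoeff 2 2 (powerSumCoeff (i + 2)) j) =
      !![-28, 32, -8, 0; -56, 56, -16, 0; 0, 0, -16, 0; 672, -864, 256, -32] := by
    ext i j
    fin_cases i <;> fin_cases j <;> rfl
  rw [h]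
  simp [Matrix.det_succ_row_zero, Fin.sum_univ_succ, Fin.succAbove]

theorem det_reduceCoeff_three_one : Matrix.det (Matrix.of fun i j : Fin 4 =>
    reduceCoeff 3 1 (powerSumCoeff (i + 1)) j) = 1024 := by
  have h : (Matrix.of fun i j : Fin 4 => reduceCoeff 3 1 (powerSumCoeff (i + 1)) j) =
      !![-2, 0, 0, 0; -16, 4, 0, 0; -72, 48, -8, 0; -256, 320, -128, 16] := by
    ext i j
    fin_cases i <;> fin_cases j <;> rfl
  rw [h]
  simp [Matrix.det_succ_row_zero, Fin.sum_univ_succ, Fin.succAbove]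

theorem det_reduceCoeff_three_two : Matrix.det (Matrix.of fun i j : Fin 4 =>
    reduceCoeff 3 2 (powerSumCoeff (i + 2)) j) = 81920 := by
  have h : (Matrix.of fun i j : Fin 4 => reduceCoeff 3 2 (powerSumCoeff (i + 2)) j) =
      !![-20, 8, 0, 0; 0, 8, 0, 0; 224, -96, 16, 0; 1408, -1056, 320, -32] := by
    ext i j
    fin_cases i <;> fin_cases j <;> rfl
  rw [h]
  simp [Matrix.det_succ_row_zero, Fin.sum_univ_succ, Fin.succAbove]

theorem det_reduceCoeff_three_three : Matrix.det (Matrix.of fun i j : Fin 4 =>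
    reduceCoeff 3 3 (powerSumCoeff (i + 3)) j) = 51904512 := by
  have h : (Matrix.of fun i j : Fin 4 => reduceCoeff 3 3 (powerSumCoeff (i + 3)) j) =
      !![240, -216, 96, -16; 704, -528, 192, -32; 1408, -1056, 352, -64; 0, 0, 0, -64] := by
    ext i j
    fin_cases i <;> fin_cases j <;> rfl
  rw [h]
  simp [Matrix.det_succ_row_zero, Fin.sum_univ_succ, Fin.succAbove]

/-! ### Comparison of k = 3 with k = 1 -/

theorem oneSubX_mul_baseRow_one (i : ℕ) : (oneSubX : PowerSeries ℝ) *
    (((oneSubX ^ (-((1 : ℕ) : ℤ)) : (PowerSeries ℝ)ˣ) : PowerSeries ℝ) * pivotVar ^ i) =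
      pivotVar ^ i := by
  have h := oneSubX_pow_mul_zpow 1 1 le_rfl
  rw [pow_one, Nat.sub_self, pow_zero] at h
  rw [← mul_assoc, h, one_mul]

theorem baseDet_three (n : ℕ) : baseDet 3 n = 3 ^ n * baseDet 1 n := by
  -- Chosen so that g·p_i(g) agrees with (1-g)g^i up to a constant. The rows for k = 3 times v³g
  -- then match those for k = 1 times v(1-g), whose constant terms are -1/2 and 3/2.
  let p : ℕ → Polynomial ℝ := fun i => if i = 0 then -1 else
    Polynomial.X ^ (i - 1) - Polynomial.X ^ i
  have hdeg : ∀ i, (p i).natDegree ≤ i := by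
    intro i
    rcases i with _ | i
    · simp [p]
    · simp only [p, Nat.succ_ne_zero, if_false, Nat.add_sub_cancel]
      refine (Polynomial.natDegree_sub_le _ _).trans (max_le ?_ ?_)
      · rw [Polynomial.natDegree_X_pow]; omega
      · rw [Polynomial.natDegree_X_pow]
  have hlead : ∀ i, (p i).coeff i = -1 := by
    intro i
    rcases i with _ | i
    · simp [p]
    · simp [p, Polynomial.coeff_X_pow]
  have h1 := oddDet_even_mul (h := (oneSubX : PowerSeries ℝ) * (1 - pivotVar))
    (by rw [oneSubX_mul_one_sub_pivotVar]; exact isEvenSeries_half_sum)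
    (fun i => ((oneSubX ^ (-((1 : ℕ) : ℤ)) : (PowerSeries ℝ)ˣ) : PowerSeries ℝ) * pivotVar ^ i) n
  have h2 := oddDet_even_mul isEvenSeries_oneSubX_cube_mul_pivotVar
    (fun i => ((oneSubX ^ (-((3 : ℕ) : ℤ)) : (PowerSeries ℝ)ˣ) : PowerSeries ℝ) *
      Polynomial.aeval pivotVar (p i)) n
  have h3 := oneSubX_pow_mul_zpow 3 3 le_rfl
  rw [Nat.sub_self, pow_zero] at h3
  rw [oddDet_congr (g := fun i => (oneSubX : PowerSeries ℝ) * (1 - pivotVar) *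
    (((oneSubX ^ (-((1 : ℕ) : ℤ)) : (PowerSeries ℝ)ˣ) : PowerSeries ℝ) * pivotVar ^ i)), h1,
    oneSubX_mul_one_sub_pivotVar, constantCoeff_oneSubX_cube_mul_pivotVar, oddDet_aeval,
    coeffDet_triangular _ _ hdeg] at h2
  · simp only [hlead, Finset.prod_const, Finset.card_range] at h2
    have hw : constantCoeff (C (1 / 2) * (3 + (X : PowerSeries ℝ) ^ 2)) = 1 / 2 * 3 := by
      rw [← map_ofNat C 3]
      simp
    rw [hw, ← mul_assoc, ← mul_pow (-(1 / 2) : ℝ) (-1)] at h2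
    change _ * baseDet 1 n = _ * baseDet 3 n at h2
    rw [neg_mul_neg, mul_one, mul_pow, mul_assoc] at h2
    have h4 : ((1 : ℝ) / 2) ^ n ≠ 0 := by positivity
    exact (mul_left_cancel₀ h4 h2).symm
  · intro i hi
    exact (hdeg i).trans_lt hi
  · intro i _
    have e : (oneSubX : PowerSeries ℝ) ^ 3 * pivotVar *
        (((oneSubX ^ (-((3 : ℕ) : ℤ)) : (PowerSeries ℝ)ˣ) : PowerSeries ℝ) *
          Polynomial.aeval pivotVar (p i)) = pivotVar * Polynomial.aeval pivotVar (p i) := by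
      linear_combination pivotVar * Polynomial.aeval pivotVar (p i) * h3
    have e1 := oneSubX_mul_baseRow_one i
    have e2 : (oneSubX : PowerSeries ℝ) * (1 - pivotVar) *
      (((oneSubX ^ (-((1 : ℕ) : ℤ)) : (PowerSeries ℝ)ˣ) : PowerSeries ℝ) * pivotVar ^ i) =
        (1 - pivotVar) * pivotVar ^ i := by
      linear_combination (1 - pivotVar) * e1
    rw [e, e2]
    rcases i with _ | i
    · have : pivotVar * Polynomial.aeval pivotVar (p 0) - (1 - pivotVar) * pivotVar ^ 0 =
          C (-1) := by
        simp [p]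
        ring
      rw [this]
      exact IsEvenSeries.const _
    · have : pivotVar * Polynomial.aeval pivotVar (p (i + 1)) -
          (1 - pivotVar) * pivotVar ^ (i + 1) = C 0 := by
        simp [p]
        ring
      rw [this]
      exact IsEvenSeries.const _

theorem detF_three (n : ℕ) : detF 1 0 3 3 n = 3 ^ n * detF 1 0 1 1 n := by
  have h1 := detF_one_zero 1 n
  have h3 := detF_one_zero 3 n
  rw [Nat.cast_one] at h1
  rw [Nat.cast_ofNat] at h3
  rw [h1, h3, baseDet_three]
  ring

/-! ### Pivots and Gamma quotients -/

/-- Each enlargement multiplies `coeffDet powerSum` by (-2)^m and divides `baseDet` by the pivot's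
leading coefficient; `t` is the quotient. -/
theorem coeffDet_powerSum_mul_baseDet {k : ℕ} {lead t : ℕ → ℝ}
    (h : ∀ m, lead m * baseDet k (m + 1) = baseDet k m)
    (ht : ∀ m, t (m + 1) * lead m = (-2) ^ m) (n : ℕ) :
    coeffDet powerSum (n + 1) * baseDet k (n + 1) = 2 * ∏ i ∈ Finset.Icc 1 (n + 1), t i := by
  induction n with
  | zero =>
    have h0 : baseDet k 0 = 1 := by simp [baseDet, oddDet]
    have h1 := h 0
    have h2 := ht 0
    rw [h0] at h1
    rw [coeffDet_powerSum_succ]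
    simp only [Finset.range_zero, Finset.prod_empty, zero_add, Finset.Icc_self,
      Finset.prod_singleton] at *
    rw [pow_zero] at h2
    linear_combination 2 * t 1 * h1 - 2 * baseDet k 1 * h2
  | succ n ih =>
    have h1 := h (n + 1)
    have h2 := ht (n + 1)
    rw [Finset.prod_Icc_succ_top (by omega), ← mul_assoc, ← ih, coeffDet_powerSum_succ,
      coeffDet_powerSum_succ, Finset.prod_range_succ]
    linear_combination 2 * (∏ i ∈ Finset.range n, (-2 : ℝ) ^ (i + 1)) *
      (t (n + 1 + 1) * h1 - baseDet k (n + 1 + 1) * h2)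

theorem mul_pivotLead_eq {k : ℕ} {a b : ℝ} {t : ℕ → ℝ} (h1 : t 1 * a = 1) (h2 : t 2 * b = -2)
    (h : ∀ m : ℕ, t (m + 3) * ladderCoeff k m = t (m + 1)) (m : ℕ) :
    t (m + 1) * pivotLead k a b m = (-2) ^ m := by
  induction m using Nat.twoStepInduction with
  | zero => simpa [pivotLead] using h1
  | one => simpa [pivotLead] using h2
  | more m ih _ =>
    rw [pivotLead]
    linear_combination 4 * pivotLead k a b m * h m + 4 * ih

theorem Gamma_add_three {s : ℝ} (hs : 0 < s) :
    Real.Gamma (s + 3) = (s + 2) * (s + 1) * s * Real.Gamma s := by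
  have e : s + 3 = s + 1 + 1 + 1 := by ring
  rw [e, Real.Gamma_add_one (by positivity), Real.Gamma_add_one (by positivity),
    Real.Gamma_add_one (by positivity)]
  ring

theorem Gamma_add_four {s : ℝ} (hs : 0 < s) :
    Real.Gamma (s + 4) = (s + 3) * (s + 2) * (s + 1) * s * Real.Gamma s := by
  have e : s + 4 = s + 3 + 1 := by ring
  rw [e, Real.Gamma_add_one (by positivity), Gamma_add_three hs]
  ring

theorem Gamma_add_six {s : ℝ} (hs : 0 < s) : Real.Gamma (s + 6) =
    (s + 5) * (s + 4) * (s + 3) * (s + 2) * (s + 1) * s * Real.Gamma s := by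
  have e : s + 6 = s + 3 + 3 := by ring
  rw [e, Gamma_add_three (by positivity), Gamma_add_three hs]
  ring

/-- The factors of the product formula for `detF 1 0 1 1`. -/
noncomputable def gammaFactorOne (i : ℕ) : ℝ :=
  ((3 : ℝ) ^ (i - 1) * Real.Gamma (3 * (i : ℝ) - 1) * Real.Gamma (((i : ℝ) + 1) / 2))
    / (Real.Gamma (2 * (i : ℝ)) * Real.Gamma ((3 * (i : ℝ) - 1) / 2))

/-- The factors of the product formula for `detF 1 0 2 2`. -/
noncomputable def gammaFactorTwo (i : ℕ) : ℝ :=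
  ((3 : ℝ) ^ (i - 1) * Real.Gamma (3 * (i : ℝ)) * Real.Gamma ((i : ℝ) / 2))
    / (2 * Real.Gamma (2 * (i : ℝ)) * Real.Gamma (3 * (i : ℝ) / 2))

/-- A step of two in the index moves even the half-integral Gamma arguments by integers, so the
quotient is rational; 9(m+2)² - k² supplies the linear factors that remain. -/
theorem gammaFactorOne_add_two (m : ℕ) :
    gammaFactorOne (m + 3) * ladderCoeff ((1 : ℕ) : ℝ) m = gammaFactorOne (m + 1) := by
  have hm : (0 : ℝ) ≤ m := m.cast_nonneg
  unfold gammaFactorOne ladderCoeff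
  have p1 : (0 : ℝ) < 3 * m + 2 := by positivity
  have p2 : (0 : ℝ) < 2 * m + 2 := by positivity
  have p3 : (0 : ℝ) < (m + 2) / 2 := by positivity
  have p4 : (0 : ℝ) < (3 * m + 2) / 2 := by positivity
  have e1 : 3 * ((m + 3 : ℕ) : ℝ) - 1 = (3 * m + 2) + 6 := by push_cast; ring
  have e2 : 2 * ((m + 3 : ℕ) : ℝ) = (2 * m + 2) + 4 := by push_cast; ring
  have e3 : (((m + 3 : ℕ) : ℝ) + 1) / 2 = (m + 2) / 2 + 1 := by push_cast; ring
  have e4 : (3 * m + 2 + 6) / 2 = (3 * (m : ℝ) + 2) / 2 + 3 := by ring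
  have f1 : 3 * ((m + 1 : ℕ) : ℝ) - 1 = 3 * m + 2 := by push_cast; ring
  have f2 : 2 * ((m + 1 : ℕ) : ℝ) = 2 * m + 2 := by push_cast; ring
  have f3 : (((m + 1 : ℕ) : ℝ) + 1) / 2 = (m + 2) / 2 := by push_cast; ring
  rw [e1, e2, e3, e4, f1, f2, f3, Gamma_add_six p1, Gamma_add_four p2,
    Real.Gamma_add_one p3.ne', Gamma_add_three p4]
  have g2 := (Real.Gamma_pos_of_pos p2).ne'
  have g4 := (Real.Gamma_pos_of_pos p4).ne'
  have hpow : (3 : ℝ) ^ (m + 3 - 1) = 9 * 3 ^ (m + 1 - 1) := by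
    rw [show m + 3 - 1 = m + 2 by omega, Nat.add_sub_cancel]; ring
  rw [hpow]
  have e : 9 * ((m : ℝ) + 2) ^ 2 - ((1 : ℕ) : ℝ) ^ 2 = (3 * m + 5) * (3 * m + 7) := by
    push_cast; ring
  rw [e]
  generalize Real.Gamma (3 * (m : ℝ) + 2) = G1
  generalize Real.Gamma (2 * (m : ℝ) + 2) = G2 at *
  generalize Real.Gamma (((m : ℝ) + 2) / 2) = G3
  generalize Real.Gamma ((3 * (m : ℝ) + 2) / 2) = G4 at *
  generalize (3 : ℝ) ^ (m + 1 - 1) = T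
  generalize (m : ℝ) = x at *
  rw [div_mul_div_comm, div_eq_div_iff (by positivity) (by positivity)]
  ring

theorem gammaFactorTwo_add_two (m : ℕ) :
    gammaFactorTwo (m + 3) * ladderCoeff ((2 : ℕ) : ℝ) m = gammaFactorTwo (m + 1) := by
  have hm : (0 : ℝ) ≤ m := m.cast_nonneg
  unfold gammaFactorTwo ladderCoeff
  have p1 : (0 : ℝ) < 3 * m + 3 := by positivity
  have p2 : (0 : ℝ) < 2 * m + 2 := by positivity
  have p3 : (0 : ℝ) < (m + 1) / 2 := by positivity
  have p4 : (0 : ℝ) < (3 * m + 3) / 2 := by positivity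
  have e1 : 3 * ((m + 3 : ℕ) : ℝ) = (3 * m + 3) + 6 := by push_cast; ring
  have e2 : 2 * ((m + 3 : ℕ) : ℝ) = (2 * m + 2) + 4 := by push_cast; ring
  have e3 : ((m + 3 : ℕ) : ℝ) / 2 = (m + 1) / 2 + 1 := by push_cast; ring
  have e4 : (3 * m + 3 + 6) / 2 = (3 * (m : ℝ) + 3) / 2 + 3 := by ring
  have f1 : 3 * ((m + 1 : ℕ) : ℝ) = 3 * m + 3 := by push_cast; ring
  have f2 : 2 * ((m + 1 : ℕ) : ℝ) = 2 * m + 2 := by push_cast; ring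
  have f3 : ((m + 1 : ℕ) : ℝ) / 2 = (m + 1) / 2 := by push_cast; ring
  rw [e1, e2, e3, e4, f1, f2, f3, Gamma_add_six p1, Gamma_add_four p2,
    Real.Gamma_add_one p3.ne', Gamma_add_three p4]
  have g2 := (Real.Gamma_pos_of_pos p2).ne'
  have g4 := (Real.Gamma_pos_of_pos p4).ne'
  have hpow : (3 : ℝ) ^ (m + 3 - 1) = 9 * 3 ^ (m + 1 - 1) := by
    rw [show m + 3 - 1 = m + 2 by omega, Nat.add_sub_cancel]; ring
  rw [hpow]
  have e : 9 * ((m : ℝ) + 2) ^ 2 - ((2 : ℕ) : ℝ) ^ 2 = (3 * m + 4) * (3 * m + 8) := by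
    push_cast; ring
  rw [e]
  generalize Real.Gamma (3 * (m : ℝ) + 3) = G1
  generalize Real.Gamma (2 * (m : ℝ) + 2) = G2 at *
  generalize Real.Gamma (((m : ℝ) + 1) / 2) = G3
  generalize Real.Gamma ((3 * (m : ℝ) + 3) / 2) = G4 at *
  generalize (3 : ℝ) ^ (m + 1 - 1) = T
  generalize (m : ℝ) = x at *
  rw [div_mul_div_comm, div_eq_div_iff (by positivity) (by positivity)]
  ring

theorem gammaFactorOne_one : gammaFactorOne 1 = 1 := by
  norm_num [gammaFactorOne, Real.Gamma_two, Real.Gamma_one]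

theorem gammaFactorOne_two : gammaFactorOne 2 = 8 := by
  have h1 : Real.Gamma 5 = 24 := by
    rw [show (5 : ℝ) = (4 : ℕ) + 1 by norm_num, Real.Gamma_nat_eq_factorial]
    norm_num [Nat.factorial]
  have h2 : Real.Gamma 4 = 6 := by
    rw [show (4 : ℝ) = (3 : ℕ) + 1 by norm_num, Real.Gamma_nat_eq_factorial]
    norm_num [Nat.factorial]
  have h3 : Real.Gamma (5 / 2) = 3 / 2 * Real.Gamma (3 / 2) := by
    rw [← Real.Gamma_add_one (by norm_num)]
    norm_num
  have h4 : Real.Gamma (3 / 2) ≠ 0 := (Real.Gamma_pos_of_pos (by norm_num)).ne'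
  norm_num [gammaFactorOne, h1, h2, h3]
  field_simp
  norm_num

theorem gammaFactorTwo_one : gammaFactorTwo 1 = 2 := by
  have h1 : Real.Gamma 3 = 2 := by
    rw [show (3 : ℝ) = (2 : ℕ) + 1 by norm_num, Real.Gamma_nat_eq_factorial]
    norm_num [Nat.factorial]
  have h3 : Real.Gamma (3 / 2) = 1 / 2 * Real.Gamma (1 / 2) := by
    rw [← Real.Gamma_add_one (by norm_num)]
    norm_num
  have h4 : Real.Gamma (1 / 2) ≠ 0 := (Real.Gamma_pos_of_pos (by norm_num)).ne'
  simp only [gammaFactorTwo, Nat.cast_one, mul_one, h1, h3, Real.Gamma_two]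
  field_simp
  norm_num

theorem gammaFactorTwo_two : gammaFactorTwo 2 = 15 := by
  have h1 : Real.Gamma 6 = 120 := by
    rw [show (6 : ℝ) = (5 : ℕ) + 1 by norm_num, Real.Gamma_nat_eq_factorial]
    norm_num [Nat.factorial]
  have h2 : Real.Gamma 4 = 6 := by
    rw [show (4 : ℝ) = (3 : ℕ) + 1 by norm_num, Real.Gamma_nat_eq_factorial]
    norm_num [Nat.factorial]
  have h3 : Real.Gamma 3 = 2 := by
    rw [show (3 : ℝ) = (2 : ℕ) + 1 by norm_num, Real.Gamma_nat_eq_factorial]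
    norm_num [Nat.factorial]
  norm_num [gammaFactorTwo, h1, h2, h3, Real.Gamma_one]

theorem detF_one_one_eq_prod {n : ℕ} (hn : 1 ≤ n) :
    detF 1 0 1 1 n = 2 * ∏ i ∈ Finset.Icc 1 n, gammaFactorOne i := by
  obtain ⟨n, rfl⟩ := Nat.exists_eq_add_of_le' hn
  have h := detF_one_zero 1 (n + 1)
  rw [Nat.cast_one] at h
  rw [h]
  exact coeffDet_powerSum_mul_baseDet pivotLead_mul_baseDet_one
    (mul_pivotLead_eq (by rw [gammaFactorOne_one]; norm_num)
      (by rw [gammaFactorOne_two]; norm_num) gammaFactorOne_add_two) n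

theorem detF_two_two_eq_prod {n : ℕ} (hn : 1 ≤ n) :
    detF 1 0 2 2 n = 2 * ∏ i ∈ Finset.Icc 1 n, gammaFactorTwo i := by
  obtain ⟨n, rfl⟩ := Nat.exists_eq_add_of_le' hn
  have h := detF_one_zero 2 (n + 1)
  rw [Nat.cast_ofNat] at h
  rw [h]
  exact coeffDet_powerSum_mul_baseDet pivotLead_mul_baseDet_two
    (mul_pivotLead_eq (by rw [gammaFactorTwo_one]; norm_num)
      (by rw [gammaFactorTwo_two]; norm_num) gammaFactorTwo_add_two) n

theorem detF_three_three_eq_prod {n : ℕ} (hn : 1 ≤ n) :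
    detF 1 0 3 3 n = 2 * ∏ i ∈ Finset.Icc 1 n,
      ((3 : ℝ) ^ i * Real.Gamma (3 * (i : ℝ) - 1) * Real.Gamma (((i : ℝ) + 1) / 2))
        / (Real.Gamma (2 * (i : ℝ)) * Real.Gamma ((3 * (i : ℝ) - 1) / 2)) := by
  have h : ∏ i ∈ Finset.Icc 1 n,
      ((3 : ℝ) ^ i * Real.Gamma (3 * (i : ℝ) - 1) * Real.Gamma (((i : ℝ) + 1) / 2))
        / (Real.Gamma (2 * (i : ℝ)) * Real.Gamma ((3 * (i : ℝ) - 1) / 2)) =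
      ∏ i ∈ Finset.Icc 1 n, 3 * gammaFactorOne i := by
    refine Finset.prod_congr rfl fun i hi => ?_
    obtain ⟨j, rfl⟩ := Nat.exists_eq_add_of_le' (Finset.mem_Icc.1 hi).1
    rw [gammaFactorOne, Nat.add_sub_cancel, pow_succ]
    ring
  rw [detF_three, detF_one_one_eq_prod hn, h, Finset.prod_mul_distrib, Finset.prod_const,
    Nat.card_Icc, Nat.add_sub_cancel]
  ring

/-! ### Identities that lower the size -/

/-- The row is the polynomial 16 + (1-X)⁴, so from degree 3 on its only odd term is -4X³. -/
theorem coeff_rowSeries_two_two (j : ℕ) :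
    coeff (2 * j + 3) (rowSeries 2 2) = if j = 0 then -4 else 0 := by
  have h : rowSeries 2 2 = C 17 - C 4 * X + C 6 * X ^ 2 - C 4 * X ^ 3 + X ^ 4 := by
    have e := oneSubX_mul_fourDiv
    rw [rowSeries, zpow_ofNat, Units.val_pow_eq_pow_val, oneSubX_val] at *
    simp only [map_ofNat]
    linear_combination ((1 - X) * fourDiv + 4) * e
  rw [h]
  simp only [map_add, map_sub, coeff_C_mul, coeff_C, coeff_X, coeff_X_pow]
  rcases j with _ | j
  · norm_num
  · simp [show ¬ 2 * (j + 1) + 3 = 1 by omega, show ¬ 2 * (j + 1) + 3 = 2 by omega,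
      show ¬ 2 * (j + 1) + 3 = 4 by omega]

theorem coeff_rowSeries_one_one (j : ℕ) :
    coeff (2 * j + 1) (rowSeries 1 1) = if j = 0 then -2 else 0 := by
  have h : rowSeries 1 1 = C 5 - C 2 * X + X ^ 2 := by
    have e := oneSubX_mul_fourDiv
    rw [rowSeries, zpow_one, oneSubX_val] at *
    simp only [map_ofNat]
    linear_combination e
  rw [h]
  simp only [map_add, map_sub, coeff_C_mul, coeff_C, coeff_X, coeff_X_pow]
  rcases j with _ | j
  · norm_num
  · simp [show ¬ 2 * (j + 1) + 1 = 2 by omega]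

/-- In terms of g the combination is v²(2 + 2g - g²) = 3v² - (v(1-g))², and the last square is even.
-/
theorem isEvenSeries_rowSeries_combination :
    IsEvenSeries (rowSeries 2 1 + (-(1 / 4) : ℝ) • rowSeries 2 2 - C 3 * (1 - X) ^ 2) := by
  have h := isEvenSeries_half_sum.pow 2
  rw [← oneSubX_mul_one_sub_pivotVar] at h
  have e := oneSubX_mul_fourDiv
  have e2 : (4 : PowerSeries ℝ) * C (1 / 4) = 1 := by
    rw [← map_ofNat C 4, ← map_mul, ← map_one C]; norm_num
  have hv := fourDiv_add_oneSubX
  have h4 : (4 : PowerSeries ℝ) * (rowSeries 2 1 + (-(1 / 4) : ℝ) • rowSeries 2 2 -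
      C 3 * (1 - X) ^ 2) = 4 * (C (-1) * ((oneSubX : PowerSeries ℝ) * (1 - pivotVar)) ^ 2) := by
    rw [smul_eq_C_mul, rowSeries, rowSeries, zpow_ofNat, Units.val_pow_eq_pow_val,
      oneSubX_val] at *
    simp only [map_ofNat, map_neg, map_one]
    linear_combination -(1 - X) ^ 2 * (fourDiv ^ 2 + (1 - X) ^ 2) * e2 + 2 * (1 - X) ^ 2 * e -
      (1 - X) ^ 2 * (fourDiv + (1 - X) - 2 * pivotVar) * hv
  have h0 : (4 : PowerSeries ℝ) ≠ 0 := by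
    rw [← map_ofNat C 4, Ne, map_eq_zero_iff _ C_injective]
    norm_num
  have h5 := mul_left_cancel₀ h0 h4
  rw [h5]
  exact (IsEvenSeries.const _).mul h

/-- Modulo even series the modified first row is 3(1-X)², whose only odd term is -6X; expanding
along it raises α by 2 and β by 1. -/
theorem detF_one_one_eq_detF_three_two {n : ℕ} (hn : 2 ≤ n) :
    detF 1 1 (-1) (-3) n = -6 * detF 3 2 2 (-2) (n - 1) := by
  obtain ⟨n, rfl⟩ := Nat.exists_eq_add_of_le' hn
  have h1 := detF_eq 1 1 2 (-1) (-3) (n + 2) (by norm_num) (by norm_num)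
  have h3 := detF_eq 3 2 2 2 (-2) (n + 1) (by norm_num) (by norm_num)
  norm_num only [Nat.cast_one, Nat.cast_ofNat] at h1 h3
  let f : ℕ → PowerSeries ℝ := fun i => rowSeries 2 (i + 1)
  let g : ℕ → PowerSeries ℝ := fun i =>
    if i = 0 then f 0 + (-(1 / 4) : ℝ) • f 1 else f i
  let h : ℕ → PowerSeries ℝ := fun i => if i = 0 then C 3 * (1 - X) ^ 2 else f i
  have e1 : oddDet g (n + 2) = oddDet f (n + 2) :=
    oddDet_add_smul_first (-(1 / 4)) (by simp [g]) (by simp [g])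
  have e2 : oddDet g (n + 2) = oddDet h (n + 2) := by
    refine oddDet_congr fun i _ => ?_
    rcases i with _ | i
    · exact isEvenSeries_rowSeries_combination
    · simpa [g, h] using IsEvenSeries.const 0
  have hcoeff : ∀ j, coeff (2 * j + 1) (h 0) = if j = 0 then -6 else 0 := by
    intro j
    have : h 0 = C 3 - C 6 * X + C 3 * X ^ 2 := by
      simp only [h, if_true, map_ofNat]
      ring
    rw [this]
    simp only [map_add, map_sub, coeff_C_mul, coeff_C, coeff_X, coeff_X_pow]
    rcases j with _ | j
    · norm_num
    · simp [show ¬ 2 * (j + 1) + 1 = 2 by omega]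
  have e3 := det_coeff_succ_of_first 1 h (n + 1) fun j hj => by
    rw [hcoeff, if_neg (by omega)]
  have h0 := hcoeff 0
  rw [mul_zero, zero_add, if_pos rfl] at h0
  rw [h0] at e3
  rw [h1, show n + 2 - 1 = n + 1 by omega, h3]
  exact (e1.symm.trans e2).trans e3

theorem detF_three_two_eq_detF_five_three {n : ℕ} (hn : 1 ≤ n) :
    detF 3 2 2 (-2) n = -4 * detF 5 3 5 (-1) (n - 1) := by
  obtain ⟨n, rfl⟩ := Nat.exists_eq_add_of_le' hn
  have h3 := detF_eq 3 2 2 2 (-2) (n + 1) (by norm_num) (by norm_num)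
  have h5 := detF_eq 5 3 2 5 (-1) n (by norm_num) (by norm_num)
  norm_num only [Nat.cast_ofNat] at h3 h5
  have e := det_coeff_succ_of_first 3 (fun i => rowSeries 2 (i + 2)) n fun j hj => by
    rw [zero_add, coeff_rowSeries_two_two, if_neg (by omega)]
  have h0 := coeff_rowSeries_two_two 0
  rw [mul_zero, zero_add, if_pos rfl] at h0
  rw [zero_add, h0] at e
  rw [h3, Nat.add_sub_cancel, h5]
  exact e

theorem detF_one_one_zero_eq_detF_three_two {n : ℕ} (hn : 1 ≤ n) :
    detF 1 1 0 (-2) n = -2 * detF 3 2 3 (-1) (n - 1) := by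
  obtain ⟨n, rfl⟩ := Nat.exists_eq_add_of_le' hn
  have h1 := detF_eq 1 1 1 0 (-2) (n + 1) (by norm_num) (by norm_num)
  have h3 := detF_eq 3 2 1 3 (-1) n (by norm_num) (by norm_num)
  norm_num only [Nat.cast_one, Nat.cast_ofNat] at h1 h3
  have e := det_coeff_succ_of_first 1 (fun i => rowSeries 1 (i + 1)) n fun j hj => by
    rw [zero_add, coeff_rowSeries_one_one, if_neg (by omega)]
  have h0 := coeff_rowSeries_one_one 0
  rw [mul_zero, zero_add, if_pos rfl] at h0
  rw [zero_add, h0] at e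
  rw [h1, Nat.add_sub_cancel, h3]
  exact e

theorem detF_shift_of_det {k m : ℕ} {d : ℤ} {c : ℝ} (hk : k ≤ 3) (hm : 2 * m ≤ 3 + k)
    (hd : Matrix.det (Matrix.of fun i j : Fin 4 =>
      reduceCoeff k m (powerSumCoeff (i + m)) j) = d)
    (hc : (-(1 / 2)) ^ (m * 4) * (d : ℝ) = c * 128)
    {γ δ : ℝ} (hγ : γ = k - 2 * m) (hδ : δ = k - 4 * m) {n : ℕ} (hn : 4 ≤ n) :
    detF 1 m γ δ n = c * detF 1 0 k k n :=
  detF_shift hk hm (by rw [coeffDet_reduce_powerSum, hd, hc]) hγ hδ hn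

theorem theorem7p1 :
    (∀ n : ℕ, 1 ≤ n →
      detF 1 0 1 1 n = 2 * ∏ i ∈ Finset.Icc 1 n,
          ((3 : ℝ) ^ (i - 1) * Real.Gamma (3 * (i : ℝ) - 1) * Real.Gamma (((i : ℝ) + 1) / 2))
            / (Real.Gamma (2 * (i : ℝ)) * Real.Gamma ((3 * (i : ℝ) - 1) / 2)) ∧
      detF 1 0 2 2 n = 2 * ∏ i ∈ Finset.Icc 1 n,
          ((3 : ℝ) ^ (i - 1) * Real.Gamma (3 * (i : ℝ)) * Real.Gamma ((i : ℝ) / 2))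
            / (2 * Real.Gamma (2 * (i : ℝ)) * Real.Gamma (3 * (i : ℝ) / 2)) ∧
      detF 1 0 3 3 n = 2 * ∏ i ∈ Finset.Icc 1 n,
          ((3 : ℝ) ^ i * Real.Gamma (3 * (i : ℝ) - 1) * Real.Gamma (((i : ℝ) + 1) / 2))
            / (Real.Gamma (2 * (i : ℝ)) * Real.Gamma ((3 * (i : ℝ) - 1) / 2))) ∧
    (∀ n : ℕ, 4 ≤ n →
      (detF 1 0 1 1 n = 2 / 3 * detF 1 1 (-1) (-3) n ∧
        detF 1 0 1 1 n = 1 / 21 * detF 1 2 (-3) (-7) n) ∧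
      (detF 1 0 2 2 n = -2 * detF 1 1 0 (-2) n ∧
        detF 1 0 2 2 n = 2 / 7 * detF 1 2 (-2) (-6) n) ∧
      (detF 1 0 3 3 n = 2 * detF 1 1 1 (-1) n ∧
        detF 1 0 3 3 n = 2 / 5 * detF 1 2 (-1) (-5) n ∧
        detF 1 0 3 3 n = 1 / 99 * detF 1 3 (-3) (-9) n) ∧
      (detF 1 1 (-1) (-3) n = -6 * detF 3 2 2 (-2) (n - 1) ∧
        detF 1 1 (-1) (-3) n = 24 * detF 5 3 5 (-1) (n - 2)) ∧
      detF 1 1 0 (-2) n = -2 * detF 3 2 3 (-1) (n - 1)) := by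
  refine ⟨fun n hn => ⟨detF_one_one_eq_prod hn, detF_two_two_eq_prod hn,
    detF_three_three_eq_prod hn⟩, fun n hn => ?_⟩
  -- Each constant c is the 4 × 4 determinant divided by 128·16^m; the stated factors are the
  -- inverses 1/c.
  have h11 := detF_shift_of_det (γ := -1) (δ := -3) (c := 3 / 2) (by norm_num) (by norm_num)
    det_reduceCoeff_one_one (by norm_num) (by norm_num) (by norm_num) hn
  have h12 := detF_shift_of_det (γ := -3) (δ := -7) (c := 21) (by norm_num) (by norm_num)
    det_reduceCoeff_one_two (by norm_num) (by norm_num) (by norm_num) hn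
  have h21 := detF_shift_of_det (γ := 0) (δ := -2) (c := -(1 / 2)) (by norm_num) (by norm_num)
    det_reduceCoeff_two_one (by norm_num) (by norm_num) (by norm_num) hn
  have h22 := detF_shift_of_det (γ := -2) (δ := -6) (c := 7 / 2) (by norm_num) (by norm_num)
    det_reduceCoeff_two_two (by norm_num) (by norm_num) (by norm_num) hn
  have h31 := detF_shift_of_det (γ := 1) (δ := -1) (c := 1 / 2) (by norm_num) (by norm_num)
    det_reduceCoeff_three_one (by norm_num) (by norm_num) (by norm_num) hn
  have h32 := detF_shift_of_det (γ := -1) (δ := -5) (c := 5 / 2) (by norm_num) (by norm_num)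
    det_reduceCoeff_three_two (by norm_num) (by norm_num) (by norm_num) hn
  have h33 := detF_shift_of_det (γ := -3) (δ := -9) (c := 99) (by norm_num) (by norm_num)
    det_reduceCoeff_three_three (by norm_num) (by norm_num) (by norm_num) hn
  simp only [Nat.cast_one, Nat.cast_ofNat] at h11 h12 h21 h22 h31 h32 h33
  have hA := detF_one_one_eq_detF_three_two (n := n) (by omega)
  have hB := detF_three_two_eq_detF_five_three (n := n - 1) (by omega)
  rw [show n - 1 - 1 = n - 2 by omega] at hB
  refine ⟨⟨?_, ?_⟩, ⟨?_, ?_⟩, ⟨?_, ?_, ?_⟩, ⟨hA, ?_⟩,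
    detF_one_one_zero_eq_detF_three_two (by omega)⟩
  · rw [h11]; ring
  · rw [h12]; ring
  · rw [h21]; ring
  · rw [h22]; ring
  · rw [h31]; ring
  · rw [h32]; ring
  · rw [h33]; ring
  · rw [hA, hB]; ring
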